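/- Let $T$ be a finite tree. A set $S\subseteq V(T)$ is a $k$-metric generator for $T$ if for any two different vertices $u,v$ there are at least $k$ vertices $w\in S$ with $d_T(u,w)\neq d_T(v,w)$; the $k$-metric dimension $\dim_k(T)$ is the minimum cardinality of a $k$-metric generator. A major vertex is a vertex of degree at least three. A leaf $u$ is a terminal vertex of a major vertex $v$ if $d_T(u,v)<d_T(u,w)$ for every other major vertex $w$. Let $\mathcal M(T)$ be the set of major vertices that have at least two terminal vertices, and let $$\varsigma(T)=\min_{w\in\mathcal M(T)}\ \min\{d_T(x,w)+d_T(w,y): x\neq y \text{ terminal vertices of } w\}.$$ The $k$-metric dimension of any tree $T$ different from a path, for any positive integer $k\le\varsigma(T)$, can be computed in linear time with respect to the order of $T$. Precisely: there are one program of a random access machine and constants $c,d$ such that, for every $n$, every tree $T$ on the vertex set $\{0,\dots,n-1\}$ that is not a path, every list of the edges of $T$ (in any order, each edge given once, as a pair of endpoints in any order) and every integer $1\le k\le\varsigma(T)$, the program started on $n$, $k$ and this list halts after at most $c\,n$ steps with output $\dim_k(T)$ (in particular, $k$-metric generators exist). Here elementary instructions (constants, copying, $+$, truncated $-$, $\times$,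 integer division, indirect load and store) and tests of a register against $0$ cost one step each, and no number greater than $n^d$ is ever produced, that is, words of $O(\log n)$ bits suffice. -/

import Mathlib

/-! ### `k`-metric generators and the `k`-metric dimension of a finite graph -/

namespace KMetric

/-- `S` is a `k`-metric generator for `G`: any two different vertices `u`, `v` are distinguished
by at least `k` elements of `S`. -/
def IsGenerator {V : Type*} (G : SimpleGraph V) (k : ℕ) (S : Finset V) : Prop :=
  ∀ u v : V, u ≠ v → k ≤ (S.filter fun w => G.dist u w ≠ G.dist v w).card

/-- `dim_k(G) = d`: the graph `G` has `k`-metric generators, and the minimum cardinality of a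
`k`-metric generator for `G` is `d`. -/
def IsDimension {V : Type*} (G : SimpleGraph V) (k d : ℕ) : Prop :=
  IsLeast {m : ℕ | ∃ S : Finset V, IsGenerator G k S ∧ S.card = m} d

/-- `G` is a path `P_m` (the one-vertex graph is `P_1`). -/
def IsPathGraph {V : Type*} (G : SimpleGraph V) : Prop :=
  ∃ m : ℕ, Nonempty (G ≃g SimpleGraph.pathGraph m)

/-! ### The parameter `ς(T)` of a tree -/

/-- A major vertex: a vertex of degree at least three. -/
def IsMajor {V : Type*} (T : SimpleGraph V) (v : V) : Prop :=
  3 ≤ (T.neighborSet v).ncard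

/-- A leaf: a vertex of degree one. -/
def IsLeaf {V : Type*} (T : SimpleGraph V) (u : V) : Prop :=
  (T.neighborSet u).ncard = 1

/-- `u` is a terminal vertex of the major vertex `v`: it is a leaf, and it is strictly closer
to `v` than to every other major vertex. -/
def IsTerminal {V : Type*} (T : SimpleGraph V) (v u : V) : Prop :=
  IsMajor T v ∧ IsLeaf T u ∧ ∀ w : V, IsMajor T w → w ≠ v → T.dist u v < T.dist u w

/-- The terminal degree `ter(v)`: the number of terminal vertices of `v`. -/
noncomputable def terminalDegree {V : Type*} (T : SimpleGraph V) (v : V) : ℕ :=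
  {u : V | IsTerminal T v u}.ncard

/-- The set `M(T)` of the (exterior) major vertices whose terminal degree is greater than one. -/
def exteriorMajor {V : Type*} (T : SimpleGraph V) : Set V :=
  {w : V | IsMajor T w ∧ 1 < terminalDegree T w}

/-- `ς(w)`: the minimum, over two different terminal vertices `x`, `y` of `w`, of the length of
the path that runs from `x` to `w` and then from `w` to `y`. -/
noncomputable def localSigma {V : Type*} (T : SimpleGraph V) (w : V) : ℕ :=
  sInf {m : ℕ | ∃ x y : V, IsTerminal T w x ∧ IsTerminal T w y ∧ x ≠ y ∧
    m = T.dist x w + T.dist w y}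

/-- `ς(T)`: the minimum of `ς(w)` over all `w` in `M(T)`. -/
noncomputable def sigma {V : Type*} (T : SimpleGraph V) : ℕ :=
  sInf {m : ℕ | ∃ w ∈ exteriorMajor T, m = localSigma T w}

/-! ### Random access machines with unit cost and bounded words -/

/-- The contents of the registers and of the memory cells. -/
structure State where
  reg : ℕ → ℕ
  mem : ℕ → ℕ

/-- Elementary instructions. The first argument of all but `store` is the target register. -/
inductive Instr where
  /-- `r := c` -/
  | const (r c : ℕ)
  /-- `r := a` -/
  | move (r a : ℕ)
  /-- `r := a + b` -/
  | add (r a b : ℕ)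
  /-- `r := max (a - b) 0` -/
  | sub (r a b : ℕ)
  /-- `r := a * b` -/
  | mul (r a b : ℕ)
  /-- `r := ⌊a / b⌋` -/
  | div (r a b : ℕ)
  /-- `r := mem[a]` -/
  | load (r a : ℕ)
  /-- `mem[a] := b` -/
  | store (a b : ℕ)

/-- The value that an instruction writes. -/
def Instr.value (s : State) : Instr → ℕ
  | .const _ c => c
  | .move _ a => s.reg a
  | .add _ a b => s.reg a + s.reg b
  | .sub _ a b => s.reg a - s.reg b
  | .mul _ a b => s.reg a * s.reg b
  | .div _ a b => s.reg a / s.reg b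
  | .load _ a => s.mem (s.reg a)
  | .store _ b => s.reg b

/-- The state after an instruction. -/
def Instr.apply (s : State) (i : Instr) : State :=
  match i with
  | .const r _ => ⟨Function.update s.reg r (i.value s), s.mem⟩
  | .move r _ => ⟨Function.update s.reg r (i.value s), s.mem⟩
  | .add r _ _ => ⟨Function.update s.reg r (i.value s), s.mem⟩
  | .sub r _ _ => ⟨Function.update s.reg r (i.value s), s.mem⟩
  | .mul r _ _ => ⟨Function.update s.reg r (i.value s), s.mem⟩
  | .div r _ _ => ⟨Function.update s.reg r (i.value s), s.mem⟩
  | .load r _ => ⟨Function.update s.reg r (i.value s), s.mem⟩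
  | .store a _ => ⟨s.reg, Function.update s.mem (s.reg a) (i.value s)⟩

/-- Programs. Each of them is a finite text, and mentions finitely many registers. -/
inductive Program where
  | instr (i : Instr)
  | skip
  | seq (p q : Program)
  /-- if the register `r` is not zero then `p` else `q` -/
  | ite (r : ℕ) (p q : Program)
  /-- while the register `r` is not zero do `p` -/
  | loop (r : ℕ) (p : Program)

/-- `Exec W p s t s'`: on a machine whose words hold the numbers `0, …, W`, the program `p` started
in the state `s` halts after exactly `t` steps in the state `s'`. Every elementary instruction
and every test of a register is one step. The machine gets stuck (there is no `t` and no `s'`)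
if an instruction produces a number greater than `W`. -/
inductive Exec (W : ℕ) : Program → State → ℕ → State → Prop where
  | instr (i : Instr) (s : State) (h : i.value s ≤ W) : Exec W (.instr i) s 1 (i.apply s)
  | skip (s : State) : Exec W .skip s 1 s
  | seq {p q : Program} {s s₁ s₂ : State} {t₁ t₂ : ℕ}
      (hp : Exec W p s t₁ s₁) (hq : Exec W q s₁ t₂ s₂) : Exec W (.seq p q) s (t₁ + t₂) s₂
  | iteTrue {r : ℕ} {p q : Program} {s s₁ : State} {t : ℕ}
      (hr : s.reg r ≠ 0) (hp : Exec W p s t s₁) : Exec W (.ite r p q) s (t + 1) s₁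
  | iteFalse {r : ℕ} {p q : Program} {s s₁ : State} {t : ℕ}
      (hr : s.reg r = 0) (hq : Exec W q s t s₁) : Exec W (.ite r p q) s (t + 1) s₁
  | loopDone {r : ℕ} {p : Program} {s : State}
      (hr : s.reg r = 0) : Exec W (.loop r p) s 1 s
  | loopStep {r : ℕ} {p : Program} {s s₁ s₂ : State} {t₁ t₂ : ℕ}
      (hr : s.reg r ≠ 0) (hp : Exec W p s t₁ s₁) (hq : Exec W (.loop r p) s₁ t₂ s₂) :
      Exec W (.loop r p) s (t₁ + t₂ + 1) s₂

/-- The machine is deterministic: the number of steps and the final state are determined by the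
program and the initial state. -/
theorem Exec.unique {W : ℕ} {p : Program} {s s₁ s₂ : State} {t₁ t₂ : ℕ}
    (h₁ : Exec W p s t₁ s₁) (h₂ : Exec W p s t₂ s₂) : t₁ = t₂ ∧ s₁ = s₂ := by
  induction h₁ generalizing t₂ s₂ with
  | instr i s h => cases h₂; exact ⟨rfl, rfl⟩
  | skip s => cases h₂; exact ⟨rfl, rfl⟩
  | seq _ _ ihp ihq =>
    cases h₂ with
    | seq hp hq =>
      obtain ⟨rfl, rfl⟩ := ihp hp
      obtain ⟨rfl, rfl⟩ := ihq hq
      exact ⟨rfl, rfl⟩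
  | iteTrue hr _ ih =>
    cases h₂ with
    | iteTrue _ hp => obtain ⟨rfl, rfl⟩ := ih hp; exact ⟨rfl, rfl⟩
    | iteFalse hr' _ => exact absurd hr' hr
  | iteFalse hr _ ih =>
    cases h₂ with
    | iteTrue hr' _ => exact absurd hr hr'
    | iteFalse _ hq => obtain ⟨rfl, rfl⟩ := ih hq; exact ⟨rfl, rfl⟩
  | loopDone hr =>
    cases h₂ with
    | loopDone _ => exact ⟨rfl, rfl⟩
    | loopStep hr' _ _ => exact absurd hr hr'
  | loopStep hr _ _ ihp ihq =>
    cases h₂ with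
    | loopDone hr' => exact absurd hr' hr
    | loopStep _ hp hq =>
      obtain ⟨rfl, rfl⟩ := ihp hp
      obtain ⟨rfl, rfl⟩ := ihq hq
      exact ⟨rfl, rfl⟩

/-! ### Input -/

/-- `L` lists the edges of `G`, each exactly once, in any order, and each as an ordered pair of its
two endpoints in any of the two orders. -/
def IsEdgeList {V : Type*} (G : SimpleGraph V) (L : List (V × V)) : Prop :=
  (L.map fun e => s(e.1, e.2)).Nodup ∧
    ∀ e : Sym2 V, e ∈ L.map (fun e => s(e.1, e.2)) ↔ e ∈ G.edgeSet

/-- The initial state: the registers 0 and 1 hold `n` and `k`, the memory cells `2 * i` and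
`2 * i + 1` hold the endpoints of the edge number `i` of the list, and everything else is 0. -/
def inputState (n k : ℕ) (L : List (Fin n × Fin n)) : State where
  reg r := if r = 0 then n else if r = 1 then k else 0
  mem a := (L.flatMap fun e => [(e.1 : ℕ), (e.2 : ℕ)]).getD a 0

end KMetric

/-!
The `k`-metric dimension of a tree is given by a formula that a random access machine can evaluate
in linear time.

*The formula.* A leaf `u` is a terminal vertex of the major vertex `w` exactly if the path from `w`
to `u` has only vertices of degree two between them (`Leg.isTerminal`, `exists_leg_of_isTerminal`).
These paths without `w`, the legs, are pairwise disjoint (`legSet_unique`). The first vertices of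
two legs at `w` are distinguished only by vertices on these two legs, so a `k`-metric generator has
at least `k` elements on any two legs at `w` (`IsGenerator.le_add`). Conversely this condition is
sufficient when there is a major vertex with two legs (`isGenerator_of_two_legs`): for `u ≠ v` let
`c` be a nearest vertex among those equidistant from `u` and `v`. All vertices in the two branches
at `c` that contain `u` and `v` distinguish `u` and `v`, and each branch of a finite tree is a leg
or contains two legs of one major vertex (`exists_leg_or_fork`). So the dimension is the sum, over
all `w` with at least two legs, of the least total of numbers, at most the lengths of the legs, that
add up to at least `k` in pairs. As `k ≤ sigma T`, this least total is attained by
`m = min l (k / 2)` on a leg of the shortest length `l`, and `k - m` on each of the others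
(`isDimension_sum_share`).

*The program.* One pass over the edges computes the degree of each vertex and the sum of its
neighbours (`runs_edges`). These sums replace adjacency lists: the neighbour of a leaf is its sum,
and a vertex of degree two that is entered from `a` is left for its sum minus `a`. Climbing in this
way from each leaf to the first vertex of degree at least three finds the major vertex of the leaf
and the length of the leg, and since the legs are disjoint, all climbs together take linear time
(`runs_vertices`, `sum_dist_le_card`). A last pass over the vertices adds up the formula
(`runs_shares`).
-/

namespace KMetric

/-! ### Branches of a tree -/

section Tree

variable {V : Type*} {T : SimpleGraph V}

/-- The branch at `c` through the neighbour `a`: the vertices closer to `a` than to `c`. In a tree,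
these form the component of `a` in `T - c`. -/
def branch (T : SimpleGraph V) (c a : V) : Set V :=
  {x | T.dist a x < T.dist c x}

theorem mem_branch {c a x : V} : x ∈ branch T c a ↔ T.dist a x < T.dist c x := Iff.rfl

theorem dist_of_mem_branch {c a x : V} (h : T.Adj c a) (hx : x ∈ branch T c a) :
    T.dist c x = T.dist a x + 1 := by
  rw [mem_branch] at hx
  have := h.diff_dist_adj (u := x)
  rw [T.dist_comm (u := x) (v := c), T.dist_comm (u := x) (v := a)] at this
  omega

/-- No vertex is equidistant from two adjacent vertices of a tree, so that the two branches given by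
an edge are complementary. -/
theorem mem_branch_swap (hT : T.IsTree) {c a x : V} (h : T.Adj c a) :
    x ∈ branch T a c ↔ x ∉ branch T c a := by
  have := hT.dist_ne_of_adj x h
  rw [T.dist_comm (u := x) (v := c), T.dist_comm (u := x) (v := a)] at this
  rw [mem_branch, mem_branch]
  omega

theorem dist_of_notMem_branch (hT : T.IsTree) {c a x : V} (h : T.Adj c a)
    (hx : x ∉ branch T c a) : T.dist a x = T.dist c x + 1 :=
  dist_of_mem_branch h.symm ((mem_branch_swap hT h).2 hx)

theorem self_mem_branch {c a : V} (h : T.Adj c a) : a ∈ branch T c a := by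
  rw [mem_branch, SimpleGraph.dist_self, SimpleGraph.dist_eq_one_iff_adj.2 h]
  exact one_pos

theorem center_notMem_branch (c a : V) : c ∉ branch T c a := by
  rw [mem_branch, SimpleGraph.dist_self]
  exact Nat.not_lt_zero _

theorem exists_mem_branch (hT : T.IsTree) {c x : V} (h : c ≠ x) :
    ∃ a, T.Adj c a ∧ x ∈ branch T c a := by
  obtain ⟨p, hp⟩ := hT.connected.exists_walk_length_eq_dist c x
  cases p with
  | nil => exact absurd rfl h
  | cons hadj q =>
    refine ⟨_, hadj, ?_⟩
    rw [mem_branch, ← hp, SimpleGraph.Walk.length_cons]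
    exact Nat.lt_succ_of_le (SimpleGraph.dist_le q)

/-- Different branches at the same vertex are disjoint: a common vertex would be joined to the
centre by two paths. -/
theorem branch_unique (hT : T.IsTree) {c a b x : V} (ha : T.Adj c a) (hb : T.Adj c b)
    (hxa : x ∈ branch T c a) (hxb : x ∈ branch T c b) : a = b := by
  obtain ⟨p, hp⟩ := hT.connected.exists_walk_length_eq_dist a x
  obtain ⟨q, hq⟩ := hT.connected.exists_walk_length_eq_dist b x
  have hp' : (SimpleGraph.Walk.cons ha p).IsPath := by
    apply SimpleGraph.Walk.isPath_of_length_eq_dist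
    rw [SimpleGraph.Walk.length_cons, hp, dist_of_mem_branch ha hxa]
  have hq' : (SimpleGraph.Walk.cons hb q).IsPath := by
    apply SimpleGraph.Walk.isPath_of_length_eq_dist
    rw [SimpleGraph.Walk.length_cons, hq, dist_of_mem_branch hb hxb]
  have h := (hT.existsUnique_path c x).unique hp' hq'
  have := congrArg SimpleGraph.Walk.snd h
  simpa using this

/-- The path from a branch to a vertex outside it runs through the centre. -/
theorem dist_add_of_branch (hT : T.IsTree) {c a x v : V} (ha : T.Adj c a)
    (hx : x ∈ branch T c a) (hv : v ∉ branch T c a) :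
    T.dist x v = T.dist x c + T.dist c v := by
  induction hd : T.dist c v generalizing c a with
  | zero =>
    rw [hT.connected.dist_eq_zero_iff] at hd
    rw [hd, add_zero]
  | succ d ih =>
    have hcv : c ≠ v := by
      rintro rfl
      simp at hd
    obtain ⟨b, hb, hvb⟩ := exists_mem_branch hT hcv
    have hxb : x ∉ branch T c b := fun h => by
      obtain rfl := branch_unique hT ha hb hx h
      exact hv hvb
    have h1 := dist_of_mem_branch hb hvb
    have h2 := dist_of_notMem_branch hT hb hxb
    have h3 := ih hb.symm ((mem_branch_swap hT hb).2 hxb)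
      (fun h => (mem_branch_swap hT hb).1 h hvb) (by omega)
    rw [T.dist_comm (u := x) (v := c), h3, T.dist_comm (u := x) (v := b)]
    omega

theorem branch_subset_branch (hT : T.IsTree) {c a b : V} (hca : T.Adj c a) (hab : T.Adj a b)
    (hbc : b ≠ c) : branch T a b ⊆ branch T c a := by
  intro x hx
  by_contra h
  exact hbc (branch_unique hT hab hca.symm hx ((mem_branch_swap hT hca).2 h))

theorem branch_eq (hT : T.IsTree) {c a : V} (hca : T.Adj c a) :
    branch T c a = insert a {x | ∃ b, b ≠ c ∧ T.Adj a b ∧ x ∈ branch T a b} := by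
  ext x
  constructor
  · intro hx
    by_cases hax : a = x
    · exact Or.inl hax.symm
    · obtain ⟨b, hb, hxb⟩ := exists_mem_branch hT hax
      refine Or.inr ⟨b, ?_, hb, hxb⟩
      rintro rfl
      exact (mem_branch_swap hT hb).1 hx hxb
  · rintro (rfl | ⟨b, hbc, hab, hx⟩)
    · exact self_mem_branch hca
    · exact branch_subset_branch hT hca hab hbc hx

/-! ### Legs -/

/-- `Leg T c a u ℓ`: the branch at `c` through `a` is a path with `ℓ` vertices, from `a` to the
leaf `u`, whose vertices other than `u` have degree two in `T`. -/
inductive Leg (T : SimpleGraph V) : V → V → V → ℕ → Prop where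
  | leaf {c u : V} (h : T.Adj c u) (hu : IsLeaf T u) : Leg T c u u 1
  | step {c a b u : V} {ℓ : ℕ} (h : T.Adj c a) (hab : T.Adj a b) (hbc : b ≠ c)
      (ha : (T.neighborSet a).ncard = 2) (hb : Leg T a b u ℓ) : Leg T c a u (ℓ + 1)

theorem Leg.adj {c a u : V} {ℓ : ℕ} (h : Leg T c a u ℓ) : T.Adj c a := by
  cases h with
  | leaf h _ => exact h
  | step h _ _ _ _ => exact h

theorem Leg.isLeaf {c a u : V} {ℓ : ℕ} (h : Leg T c a u ℓ) : IsLeaf T u := by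
  induction h with
  | leaf _ h => exact h
  | step _ _ _ _ _ ih => exact ih

theorem eq_of_isLeaf {u x y : V} (h : IsLeaf T u) (hx : T.Adj u x) (hy : T.Adj u y) : x = y := by
  obtain ⟨z, hz⟩ := Set.ncard_eq_one.1 h
  have hx' : x ∈ T.neighborSet u := hx
  have hy' : y ∈ T.neighborSet u := hy
  rw [hz] at hx' hy'
  exact hx'.trans hy'.symm

theorem eq_or_eq_of_ncard_eq_two {a b c x : V} (h : (T.neighborSet a).ncard = 2)
    (hb : T.Adj a b) (hc : T.Adj a c) (hbc : b ≠ c) (hx : T.Adj a x) : x = b ∨ x = c := by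
  obtain ⟨y, z, -, hs⟩ := Set.ncard_eq_two.1 h
  have hb' : b ∈ T.neighborSet a := hb
  have hc' : c ∈ T.neighborSet a := hc
  have hx' : x ∈ T.neighborSet a := hx
  rw [hs] at hb' hc' hx'
  simp only [Set.mem_insert_iff, Set.mem_singleton_iff] at hb' hc' hx'
  grind

theorem branch_eq_of_isLeaf (hT : T.IsTree) {c u : V} (h : T.Adj c u) (hu : IsLeaf T u) :
    branch T c u = {u} := by
  rw [branch_eq hT h]
  ext x
  constructor
  · rintro (rfl | ⟨b, hbc, hb, -⟩)
    · rfl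
    · exact absurd (eq_of_isLeaf hu hb h.symm) hbc
  · rintro rfl
    exact Or.inl rfl

theorem branch_eq_of_ncard_eq_two (hT : T.IsTree) {c a b : V} (h : T.Adj c a) (hab : T.Adj a b)
    (hbc : b ≠ c) (ha : (T.neighborSet a).ncard = 2) :
    branch T c a = insert a (branch T a b) := by
  rw [branch_eq hT h]
  congr 1
  ext x
  constructor
  · rintro ⟨d, hdc, hd, hx⟩
    rcases eq_or_eq_of_ncard_eq_two ha hab h.symm hbc hd with rfl | rfl
    · exact hx
    · exact absurd rfl hdc
  · exact fun hx => ⟨b, hbc, hab, hx⟩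

theorem Leg.eq_or_ncard_eq_two (hT : T.IsTree) {c a u x : V} {ℓ : ℕ} (h : Leg T c a u ℓ)
    (hx : x ∈ branch T c a) : x = u ∨ (T.neighborSet x).ncard = 2 := by
  induction h with
  | leaf h hu =>
    rw [branch_eq_of_isLeaf hT h hu] at hx
    exact Or.inl hx
  | step h hab hbc ha _ ih =>
    rw [branch_eq_of_ncard_eq_two hT h hab hbc ha] at hx
    rcases hx with rfl | hx
    · exact Or.inr ha
    · exact ih hx

theorem Leg.not_isMajor (hT : T.IsTree) {c a u x : V} {ℓ : ℕ} (h : Leg T c a u ℓ)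
    (hx : x ∈ branch T c a) : ¬ IsMajor T x := by
  unfold IsMajor
  rcases h.eq_or_ncard_eq_two hT hx with rfl | hx
  · rw [show (T.neighborSet x).ncard = 1 from h.isLeaf]
    omega
  · omega

theorem Leg.mem_branch (hT : T.IsTree) {c a u : V} {ℓ : ℕ} (h : Leg T c a u ℓ) :
    u ∈ branch T c a := by
  induction h with
  | leaf h hu => exact self_mem_branch h
  | step h hab hbc ha _ ih => exact branch_subset_branch hT h hab hbc ih

theorem Leg.dist_eq (hT : T.IsTree) {c a u : V} {ℓ : ℕ} (h : Leg T c a u ℓ) :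
    T.dist c u = ℓ := by
  have hu := h.mem_branch hT
  induction h with
  | leaf h _ => exact SimpleGraph.dist_eq_one_iff_adj.2 h
  | step h _ _ _ hb ih => rw [dist_of_mem_branch h hu, ih (hb.mem_branch hT)]

theorem Leg.ncard_branch [Finite V] (hT : T.IsTree) {c a u : V} {ℓ : ℕ} (h : Leg T c a u ℓ) :
    (branch T c a).ncard = ℓ := by
  induction h with
  | leaf h hu => rw [branch_eq_of_isLeaf hT h hu, Set.ncard_singleton]
  | step h hab hbc ha _ ih =>
    rw [branch_eq_of_ncard_eq_two hT h hab hbc ha,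
      Set.ncard_insert_of_notMem (center_notMem_branch _ _), ih]

/-- Legs that hang at major vertices are disjoint: from a common vertex `x`, each of the two centres
would be nearer than the other one. -/
theorem Leg.centers_unique (hT : T.IsTree) {c a u c' a' u' x : V} {ℓ ℓ' : ℕ}
    (h : Leg T c a u ℓ) (h' : Leg T c' a' u' ℓ') (hc : IsMajor T c) (hc' : IsMajor T c')
    (hx : x ∈ branch T c a) (hx' : x ∈ branch T c' a') : c = c' ∧ a = a' ∧ u = u' := by
  have h1 := dist_add_of_branch hT h.adj hx fun hm => h.not_isMajor hT hm hc'
  have h2 := dist_add_of_branch hT h'.adj hx' fun hm => h'.not_isMajor hT hm hc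
  have h3 : T.dist c c' = 0 := by omega
  rw [hT.connected.dist_eq_zero_iff] at h3
  subst h3
  obtain rfl := branch_unique hT h.adj h'.adj hx hx'
  refine ⟨rfl, rfl, ?_⟩
  rcases h'.eq_or_ncard_eq_two hT (h.mem_branch hT) with h4 | h4
  · exact h4
  · have := h.isLeaf
    unfold IsLeaf at this
    omega

theorem Leg.isTerminal (hT : T.IsTree) {w b u : V} {ℓ : ℕ} (h : Leg T w b u ℓ)
    (hw : IsMajor T w) : IsTerminal T w u := by
  refine ⟨hw, h.isLeaf, fun w' hw' hne => ?_⟩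
  rw [dist_add_of_branch hT h.adj (h.mem_branch hT) fun hm => h.not_isMajor hT hm hw']
  exact Nat.lt_add_of_pos_right (hT.connected.pos_dist_of_ne hne.symm)

/-- If the centre of a leg had degree one, then the whole tree would be a path. -/
theorem Leg.not_isLeaf_center (hT : T.IsTree) {c a u w : V} {ℓ : ℕ} (h : Leg T c a u ℓ)
    (hw : IsMajor T w) : ¬ IsLeaf T c := by
  intro hc
  by_cases hcw : c = w
  · subst hcw
    unfold IsLeaf at hc
    unfold IsMajor at hw
    omega
  · obtain ⟨b, hb, hwb⟩ := exists_mem_branch hT hcw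
    obtain rfl := eq_of_isLeaf hc hb h.adj
    exact h.not_isMajor hT hwb hw

theorem neighborSet_ncard_pos [Finite V] {c a : V} (h : T.Adj c a) :
    0 < (T.neighborSet c).ncard :=
  (Set.ncard_pos (Set.toFinite _)).2 ⟨a, h⟩

theorem exists_ne_adj [Finite V] {c : V} (a : V) (h : 2 ≤ (T.neighborSet c).ncard) :
    ∃ b, T.Adj c b ∧ b ≠ a :=
  Set.exists_ne_of_one_lt_ncard h a

/-- One step up along a leg in a tree that has a major vertex. -/
theorem Leg.extend [Finite V] (hT : T.IsTree) {c a u w : V} {ℓ : ℕ} (h : Leg T c a u ℓ)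
    (hw : IsMajor T w) (hc : ¬ IsMajor T c) :
    (T.neighborSet c).ncard = 2 ∧
      ∃ d, T.Adj c d ∧ d ≠ a ∧ Leg T d c u (ℓ + 1) := by
  have h1 := neighborSet_ncard_pos h.adj
  have h2 := h.not_isLeaf_center hT hw
  unfold IsLeaf at h2
  unfold IsMajor at hc
  have h3 : (T.neighborSet c).ncard = 2 := by omega
  obtain ⟨d, hd, hda⟩ := exists_ne_adj a h3.ge
  exact ⟨h3, d, hd, hda, .step hd.symm h.adj hda.symm h3 h⟩

theorem Leg.length_lt [Finite V] (hT : T.IsTree) {c a u : V} {ℓ : ℕ} (h : Leg T c a u ℓ) :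
    ℓ < Nat.card V := by
  rw [← h.ncard_branch hT, ← Set.ncard_univ]
  exact Set.ncard_lt_ncard
    ⟨Set.subset_univ _, fun hs => center_notMem_branch c a (hs (Set.mem_univ c))⟩

/-- If there is a major vertex, then every leg extends upwards to a leg at a major vertex. -/
theorem Leg.exists_top [Finite V] (hT : T.IsTree) {c a u w : V} {ℓ : ℕ} (h : Leg T c a u ℓ)
    (hw : IsMajor T w) : ∃ v b ℓ', IsMajor T v ∧ Leg T v b u ℓ' := by
  induction hd : Nat.card V - ℓ generalizing c a ℓ with
  | zero =>
    have := h.length_lt hT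
    omega
  | succ d ih =>
    by_cases hc : IsMajor T c
    · exact ⟨c, a, ℓ, hc, h⟩
    · obtain ⟨-, e, -, -, he⟩ := h.extend hT hw hc
      exact ih he (by omega)

/-- The terminal vertices of `w` are exactly the ends of the legs at `w`; the other direction is
`Leg.isTerminal`. -/
theorem exists_leg_of_isTerminal [Finite V] (hT : T.IsTree) {w u : V} (h : IsTerminal T w u) :
    ∃ b, Leg T w b u (T.dist w u) := by
  obtain ⟨hw, hu, hlt⟩ := h
  obtain ⟨c, hc⟩ := Set.ncard_eq_one.1 hu
  have hadj : T.Adj u c := by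
    have : c ∈ T.neighborSet u := hc ▸ rfl
    exact this
  obtain ⟨v, b, ℓ, hv, hl⟩ := (Leg.leaf hadj.symm hu).exists_top hT hw
  have hvw : w = v := by
    by_contra hne
    have h1 := hlt v hv (Ne.symm hne)
    have h2 := (hl.isTerminal hT hv).2.2 w hw hne
    omega
  subst hvw
  rw [hl.dist_eq hT]
  exact ⟨b, hl⟩

/-- Every branch of a finite tree is a leg, or it contains two legs of one major vertex. -/
theorem exists_leg_or_fork [Finite V] (hT : T.IsTree) {c a : V} (h : T.Adj c a) :
    (∃ u ℓ, Leg T c a u ℓ) ∨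
      ∃ w b₁ b₂ u₁ u₂ ℓ₁ ℓ₂, IsMajor T w ∧ b₁ ≠ b₂ ∧ Leg T w b₁ u₁ ℓ₁ ∧ Leg T w b₂ u₂ ℓ₂ ∧
        branch T w b₁ ⊆ branch T c a ∧ branch T w b₂ ⊆ branch T c a := by
  induction hd : (branch T c a).ncard using Nat.strong_induction_on generalizing c a with
  | _ d ih =>
  have hlt : ∀ b, T.Adj a b → b ≠ c → (branch T a b).ncard < d := fun b hb hbc => by
    rw [← hd]
    exact Set.ncard_lt_ncard ⟨branch_subset_branch hT h hb hbc,
      fun hs => center_notMem_branch a b (hs (self_mem_branch h))⟩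
  have hup : ∀ b, T.Adj a b → b ≠ c → (∃ u ℓ, Leg T a b u ℓ) ∨
      ∃ w b₁ b₂ u₁ u₂ ℓ₁ ℓ₂, IsMajor T w ∧ b₁ ≠ b₂ ∧ Leg T w b₁ u₁ ℓ₁ ∧ Leg T w b₂ u₂ ℓ₂ ∧
        branch T w b₁ ⊆ branch T c a ∧ branch T w b₂ ⊆ branch T c a := fun b hb hbc => by
    have hsub := branch_subset_branch hT h hb hbc
    rcases ih _ (hlt b hb hbc) hb rfl with h1 | ⟨w, b₁, b₂, u₁, u₂, ℓ₁, ℓ₂, h1, h2, h3, h4, h5, h6⟩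
    · exact Or.inl h1
    · exact Or.inr ⟨w, b₁, b₂, u₁, u₂, ℓ₁, ℓ₂, h1, h2, h3, h4, h5.trans hsub, h6.trans hsub⟩
  have hpos := neighborSet_ncard_pos h.symm
  by_cases h1 : (T.neighborSet a).ncard = 1
  · exact Or.inl ⟨a, 1, .leaf h h1⟩
  obtain ⟨b, hb, hbc⟩ := exists_ne_adj c (show 2 ≤ (T.neighborSet a).ncard by omega)
  rcases hup b hb hbc with ⟨u, ℓ, hl⟩ | hf
  · by_cases h2 : (T.neighborSet a).ncard = 2
    · exact Or.inl ⟨u, ℓ + 1, .step h hb hbc h2 hl⟩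
    · have h3 : IsMajor T a := by
        unfold IsMajor
        omega
      have h4 : ({c, b} : Set V).ncard < (T.neighborSet a).ncard :=
        lt_of_le_of_lt (Set.ncard_insert_le _ _) (by rw [Set.ncard_singleton]; exact h3)
      obtain ⟨b', hb', hn⟩ := Set.exists_mem_notMem_of_ncard_lt_ncard h4
      simp only [Set.mem_insert_iff, Set.mem_singleton_iff, not_or] at hn
      rcases hup b' hb' hn.1 with ⟨u', ℓ', hl'⟩ | hf
      · exact Or.inr ⟨a, b, b', u, u', ℓ, ℓ', h3, Ne.symm hn.2, hl, hl',
          branch_subset_branch hT h hb hbc, branch_subset_branch hT h hb' hn.1⟩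
      · exact Or.inr hf
  · exact Or.inr hf

end Tree

/-! ### The dimension formula -/

section Dimension

variable {V : Type*} {T : SimpleGraph V}

/-- The vertices on the path from `w` to its terminal vertex `u`, without `w`. -/
def legSet (T : SimpleGraph V) (w u : V) : Set V :=
  {x | ∃ b ℓ, Leg T w b u ℓ ∧ x ∈ branch T w b}

theorem Leg.legSet_eq (hT : T.IsTree) {w b u : V} {ℓ : ℕ} (h : Leg T w b u ℓ) :
    legSet T w u = branch T w b := by
  ext x
  constructor
  · rintro ⟨b', ℓ', h', hx⟩
    obtain rfl := branch_unique hT h.adj h'.adj (h.mem_branch hT) (h'.mem_branch hT)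
    exact hx
  · exact fun hx => ⟨b, ℓ, h, hx⟩

theorem ncard_legSet [Finite V] (hT : T.IsTree) {w u : V} (h : IsTerminal T w u) :
    (legSet T w u).ncard = T.dist w u := by
  obtain ⟨b, hb⟩ := exists_leg_of_isTerminal hT h
  rw [hb.legSet_eq hT, hb.ncard_branch hT]

theorem IsTerminal.center_unique {w w' u : V}
    (h : IsTerminal T w u) (h' : IsTerminal T w' u) : w = w' := by
  by_contra hne
  have h1 := h.2.2 w' h'.1 (Ne.symm hne)
  have h2 := h'.2.2 w h.1 hne
  omega

theorem legSet_unique (hT : T.IsTree) {w u w' u' x : V} (hw : IsMajor T w)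
    (hw' : IsMajor T w') (hx : x ∈ legSet T w u) (hx' : x ∈ legSet T w' u') :
    w = w' ∧ u = u' := by
  obtain ⟨b, ℓ, h, hx⟩ := hx
  obtain ⟨b', ℓ', h', hx'⟩ := hx'
  obtain ⟨h1, -, h2⟩ := h.centers_unique hT h' hw hw' hx hx'
  exact ⟨h1, h2⟩

/-- The length of a shortest leg at `w`. -/
noncomputable def shortestLeg (T : SimpleGraph V) (w : V) : ℕ :=
  sInf (T.dist w '' {u | IsTerminal T w u})

theorem exists_shortestLeg {w u : V} (h : IsTerminal T w u) :
    ∃ v, IsTerminal T w v ∧ T.dist w v = shortestLeg T w :=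
  Nat.sInf_mem (s := T.dist w '' {u | IsTerminal T w u}) ⟨_, u, h, rfl⟩

theorem shortestLeg_le {w u : V} (h : IsTerminal T w u) : shortestLeg T w ≤ T.dist w u :=
  Nat.sInf_le ⟨u, h, rfl⟩

variable [Fintype V]

open Classical in
/-- The terminal vertices of `w`, as a finite set. -/
noncomputable def terminals (T : SimpleGraph V) (w : V) : Finset V :=
  Finset.univ.filter (IsTerminal T w)

theorem mem_terminals {w u : V} : u ∈ terminals T w ↔ IsTerminal T w u := by
  simp [terminals]

theorem terminalDegree_eq (T : SimpleGraph V) (w : V) :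
    terminalDegree T w = (terminals T w).card := by
  rw [terminalDegree, ← Set.ncard_coe_finset]
  congr 1
  ext u
  simp [mem_terminals]

/-- The number of vertices that a minimum `k`-metric generator has on a shortest leg at `w`. -/
noncomputable def shortShare (T : SimpleGraph V) (k : ℕ) (w : V) : ℕ :=
  min (shortestLeg T w) (k / 2)

/-- The number of vertices that a minimum `k`-metric generator has on the legs at `w`. -/
noncomputable def share (T : SimpleGraph V) (k : ℕ) (w : V) : ℕ :=
  if 1 < terminalDegree T w then
    shortShare T k w + (terminalDegree T w - 1) * (k - shortShare T k w)
  else 0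

theorem one_lt_terminalDegree {w u v : V} (hu : IsTerminal T w u) (hv : IsTerminal T w v)
    (huv : u ≠ v) : 1 < terminalDegree T w := by
  rw [terminalDegree_eq, Finset.one_lt_card]
  exact ⟨u, mem_terminals.2 hu, v, mem_terminals.2 hv, huv⟩

theorem sigma_le_add {w u v : V} (hu : IsTerminal T w u) (hv : IsTerminal T w v)
    (huv : u ≠ v) : sigma T ≤ T.dist w u + T.dist w v := by
  have h : sigma T ≤ localSigma T w :=
    Nat.sInf_le ⟨w, ⟨hu.1, one_lt_terminalDegree hu hv huv⟩, rfl⟩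
  refine h.trans ?_
  refine Nat.sInf_le ⟨u, v, hu, hv, huv, ?_⟩
  rw [T.dist_comm (u := u)]

theorem exists_two_terminals {k : ℕ} (hk : 1 ≤ k) (hks : k ≤ sigma T) :
    ∃ w u v, IsTerminal T w u ∧ IsTerminal T w v ∧ u ≠ v := by
  have hne : {m : ℕ | ∃ w ∈ exteriorMajor T, m = localSigma T w}.Nonempty := by
    apply Nat.nonempty_of_pos_sInf
    exact lt_of_lt_of_le hk hks
  obtain ⟨_, w, ⟨-, hw⟩, -⟩ := hne
  rw [terminalDegree_eq, Finset.one_lt_card] at hw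
  obtain ⟨u, hu, v, hv, huv⟩ := hw
  exact ⟨w, u, v, mem_terminals.1 hu, mem_terminals.1 hv, huv⟩

/-- Numbers that add up to at least `k` in pairs, one of which is at most `l`, have at least the sum
that is attained when one of them is `min l (k / 2)` and the others complete it to `k`. -/
theorem min_add_mul_le_sum {ι : Type*} {s : Finset ι} {a : ι → ℕ} {k l : ℕ} {i₀ : ι}
    (hs : 1 < s.card) (hi : i₀ ∈ s) (hl : a i₀ ≤ l)
    (ha : ∀ i ∈ s, ∀ j ∈ s, i ≠ j → k ≤ a i + a j) :
    min l (k / 2) + (s.card - 1) * (k - min l (k / 2)) ≤ ∑ i ∈ s, a i := by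
  classical
  obtain ⟨x, hx, hmin⟩ := Finset.exists_min_image s a ⟨i₀, hi⟩
  -- The other numbers are at least the smallest number `a x` and complete it to `k`.
  have h1 : (s.card - 1) * max (a x) (k - a x) ≤ ∑ i ∈ s.erase x, a i := by
    rw [← Finset.card_erase_of_mem hx, ← smul_eq_mul]
    refine Finset.card_nsmul_le_sum _ _ _ fun i hi => ?_
    have h2 := hmin i (Finset.mem_of_mem_erase hi)
    have h3 := ha x hx i (Finset.mem_of_mem_erase hi) (Finset.ne_of_mem_erase hi).symm
    omega
  rw [← Finset.add_sum_erase s a hx]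
  have hxl := (hmin i₀ hi).trans hl
  obtain ⟨p, hp⟩ : ∃ p, s.card - 1 = p + 1 := ⟨s.card - 2, by omega⟩
  rw [hp, Nat.succ_mul] at h1 ⊢
  by_cases hc : a x ≤ k / 2
  · have h4 : p * (k - min l (k / 2)) ≤ p * max (a x) (k - a x) :=
      Nat.mul_le_mul_left _ (by omega)
    omega
  · have h4 : p * (k - min l (k / 2)) ≤ p * max (a x) (k - a x) :=
      Nat.mul_le_mul_left _ (by omega)
    omega

open Classical in
/-- The first vertices of two legs at `w` are distinguished only by vertices on these legs. -/
theorem IsGenerator.le_add (hT : T.IsTree) {k : ℕ} {S : Finset V} (hS : IsGenerator T k S)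
    {w u v : V} (hu : IsTerminal T w u) (hv : IsTerminal T w v) (huv : u ≠ v) :
    k ≤ (S.filter (· ∈ legSet T w u)).card + (S.filter (· ∈ legSet T w v)).card := by
  obtain ⟨b, hb⟩ := exists_leg_of_isTerminal hT hu
  obtain ⟨c, hc⟩ := exists_leg_of_isTerminal hT hv
  have hbc : b ≠ c := by
    rintro rfl
    exact huv (hb.centers_unique hT hc hu.1 hu.1 (hb.mem_branch hT) (hb.mem_branch hT)).2.2
  refine (hS b c hbc).trans (le_trans (Finset.card_le_card ?_) (Finset.card_union_le _ _))
  intro x hx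
  rw [hb.legSet_eq hT, hc.legSet_eq hT, Finset.mem_union, Finset.mem_filter, Finset.mem_filter]
  rw [Finset.mem_filter] at hx
  by_contra hn
  have h1 : x ∉ branch T w b := fun h => hn (Or.inl ⟨hx.1, h⟩)
  have h2 : x ∉ branch T w c := fun h => hn (Or.inr ⟨hx.1, h⟩)
  exact hx.2 ((dist_of_notMem_branch hT hb.adj h1).trans
    (dist_of_notMem_branch hT hc.adj h2).symm)

open Classical in
/-- The local part of the lower bound: the legs at `w` contain at least `share T k w` elements of
any generator. -/
theorem share_le_sum (hT : T.IsTree) {k : ℕ} {S : Finset V} (hS : IsGenerator T k S) (w : V) :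
    share T k w ≤ ∑ u ∈ terminals T w, (S.filter (· ∈ legSet T w u)).card := by
  rw [share]
  split_ifs with hd
  · rw [terminalDegree_eq] at hd ⊢
    obtain ⟨u, hu⟩ := Finset.card_pos.1 (lt_trans one_pos hd)
    obtain ⟨v, hv, hvl⟩ := exists_shortestLeg (mem_terminals.1 hu)
    refine min_add_mul_le_sum hd (mem_terminals.2 hv) ?_ ?_
    · rw [← hvl, ← ncard_legSet hT hv, ← Set.ncard_coe_finset]
      refine Set.ncard_le_ncard fun x hx => ?_
      simp only [Finset.coe_filter, Set.mem_ofPred_eq] at hx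
      exact hx.2
    · exact fun i hi j hj hij => hS.le_add hT (mem_terminals.1 hi) (mem_terminals.1 hj) hij
  · exact Nat.zero_le _

theorem pairwiseDisjoint_of_subset_legSet (hT : T.IsTree) {C : V → V → Finset V}
    (hC : ∀ w, ∀ u ∈ terminals T w, ∀ x ∈ C w u, x ∈ legSet T w u) :
    ((Finset.univ.sigma (terminals T) : Finset (Σ _ : V, V)) : Set (Σ _ : V, V)).PairwiseDisjoint
      fun p => C p.1 p.2 := by
  rintro ⟨w, u⟩ hp ⟨w', u'⟩ hp' hne
  simp only [Finset.coe_sigma, Set.mem_sigma_iff, Finset.mem_coe] at hp hp'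
  refine Finset.disjoint_left.2 fun x hx hx' => hne ?_
  obtain ⟨rfl, rfl⟩ := legSet_unique hT (mem_terminals.1 hp.2).1 (mem_terminals.1 hp'.2).1
    (hC w u hp.2 x hx) (hC w' u' hp'.2 x hx')
  rfl

/-- The legs are disjoint, so that their total length is at most the order of the tree. This bounds
the time of the climbs. -/
theorem sum_dist_le_card (hT : T.IsTree) :
    ∑ w, ∑ u ∈ terminals T w, T.dist w u ≤ Fintype.card V := by
  classical
  have hdisj := pairwiseDisjoint_of_subset_legSet hT
    (C := fun w u => (legSet T w u).toFinset) fun w u _ x hx => Set.mem_toFinset.1 hx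
  calc ∑ w, ∑ u ∈ terminals T w, T.dist w u
      = ∑ w, ∑ u ∈ terminals T w, (legSet T w u).toFinset.card := by
        refine Finset.sum_congr rfl fun w _ => Finset.sum_congr rfl fun u hu => ?_
        rw [← Set.ncard_eq_toFinset_card', ncard_legSet hT (mem_terminals.1 hu)]
    _ = ((Finset.univ.sigma (terminals T)).biUnion
          fun p => (legSet T p.1 p.2).toFinset).card := by
        rw [Finset.card_biUnion hdisj, Finset.sum_sigma]
    _ ≤ Fintype.card V := Finset.card_le_univ _

theorem sum_share_le_card (hT : T.IsTree) {k : ℕ} {S : Finset V} (hS : IsGenerator T k S) :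
    ∑ w, share T k w ≤ S.card := by
  classical
  calc ∑ w, share T k w
      ≤ ∑ w, ∑ u ∈ terminals T w, (S.filter (· ∈ legSet T w u)).card :=
        Finset.sum_le_sum fun w _ => share_le_sum hT hS w
    _ = ((Finset.univ.sigma (terminals T)).biUnion
          fun p => S.filter (· ∈ legSet T p.1 p.2)).card := by
        rw [Finset.card_biUnion, Finset.sum_sigma]
        exact pairwiseDisjoint_of_subset_legSet hT (C := fun w u => S.filter (· ∈ legSet T w u))
          fun w u _ x hx => (Finset.mem_filter.1 hx).2
    _ ≤ S.card := Finset.card_le_card <| Finset.biUnion_subset.2 fun _ _ => Finset.filter_subset _ _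

/-- If a set has `k` elements on any two legs of the same major vertex, then it is a `k`-metric
generator. Indeed, let `c` be a vertex equidistant from `u` and `v` and nearest to them. The two
branches at `c` that contain `u` and `v` consist of vertices that distinguish `u` and `v`, and
together they contain two legs of one major vertex, unless the tree is a path. -/
theorem isGenerator_of_two_legs (hT : T.IsTree) {k : ℕ} {S : Finset V}
    (hM : ∃ w u v, IsTerminal T w u ∧ IsTerminal T w v ∧ u ≠ v)
    (hS : ∀ w u v (D : Finset V), IsTerminal T w u → IsTerminal T w v → u ≠ v →
      (∀ x ∈ S, x ∈ legSet T w u → x ∈ D) → (∀ x ∈ S, x ∈ legSet T w v → x ∈ D) → k ≤ D.card) :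
    IsGenerator T k S := by
  classical
  intro u v huv
  obtain ⟨w, x, y, hx, hy, hxy⟩ := hM
  by_cases hex : ∃ z, T.dist u z = T.dist v z
  swap
  · rw [not_exists] at hex
    rw [Finset.filter_true_of_mem fun z _ => hex z]
    exact hS w x y S hx hy hxy (fun z hz _ => hz) fun z hz _ => hz
  obtain ⟨c, hc, hmin⟩ : ∃ c, T.dist u c = T.dist v c ∧
      ∀ z, T.dist u z = T.dist v z → T.dist u c ≤ T.dist u z := by
    obtain ⟨c, hc, hmin⟩ := Finset.exists_min_image
      (Finset.univ.filter fun z => T.dist u z = T.dist v z) (T.dist u) (by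
        obtain ⟨z, hz⟩ := hex
        exact ⟨z, by simpa using hz⟩)
    refine ⟨c, by simpa using hc, fun z hz => hmin z (by simpa using hz)⟩
  have hcu : c ≠ u := by
    rintro rfl
    rw [SimpleGraph.dist_self, eq_comm, hT.connected.dist_eq_zero_iff] at hc
    exact huv hc.symm
  have hcv : c ≠ v := by
    rintro rfl
    rw [SimpleGraph.dist_self, hT.connected.dist_eq_zero_iff] at hc
    exact huv hc
  obtain ⟨a, ha, hua⟩ := exists_mem_branch hT hcu
  obtain ⟨b, hb, hvb⟩ := exists_mem_branch hT hcv
  have hda := dist_of_mem_branch ha hua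
  have hdb := dist_of_mem_branch hb hvb
  rw [T.dist_comm (u := c), T.dist_comm (u := a)] at hda
  rw [T.dist_comm (u := c), T.dist_comm (u := b)] at hdb
  have hab : a ≠ b := by
    rintro rfl
    have := hmin a (by omega)
    omega
  have hA : ∀ z ∈ branch T c a, T.dist u z ≠ T.dist v z := fun z hz => by
    have h1 := dist_add_of_branch hT hb hvb fun h => hab (branch_unique hT ha hb hz h)
    have h2 := dist_of_mem_branch ha hz
    have h3 := hT.connected.dist_triangle (u := u) (v := a) (w := z)
    omega
  have hB : ∀ z ∈ branch T c b, T.dist u z ≠ T.dist v z := fun z hz => by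
    have h1 := dist_add_of_branch hT ha hua fun h => hab (branch_unique hT ha hb h hz)
    have h2 := dist_of_mem_branch hb hz
    have h3 := hT.connected.dist_triangle (u := v) (v := b) (w := z)
    omega
  -- Two legs of one major vertex that consist of distinguishing vertices are enough.
  have key : ∀ w b₁ b₂ u₁ u₂ ℓ₁ ℓ₂, IsMajor T w → b₁ ≠ b₂ → Leg T w b₁ u₁ ℓ₁ →
      Leg T w b₂ u₂ ℓ₂ → (∀ z ∈ branch T w b₁, T.dist u z ≠ T.dist v z) →
      (∀ z ∈ branch T w b₂, T.dist u z ≠ T.dist v z) →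
      k ≤ (S.filter fun z => T.dist u z ≠ T.dist v z).card := by
    intro w b₁ b₂ u₁ u₂ ℓ₁ ℓ₂ hw hne h₁ h₂ hd₁ hd₂
    refine hS w u₁ u₂ _ (h₁.isTerminal hT hw) (h₂.isTerminal hT hw) ?_ ?_ ?_
    · rintro rfl
      exact hne (branch_unique hT h₁.adj h₂.adj (h₁.mem_branch hT) (h₂.mem_branch hT))
    · intro z hz hzl
      rw [h₁.legSet_eq hT] at hzl
      exact Finset.mem_filter.2 ⟨hz, hd₁ z hzl⟩
    · intro z hz hzl
      rw [h₂.legSet_eq hT] at hzl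
      exact Finset.mem_filter.2 ⟨hz, hd₂ z hzl⟩
  rcases exists_leg_or_fork hT ha with
    ⟨u₁, ℓ₁, h₁⟩ | ⟨w, b₁, b₂, u₁, u₂, ℓ₁, ℓ₂, h1, h2, h3, h4, h5, h6⟩
  swap
  · exact key w b₁ b₂ u₁ u₂ ℓ₁ ℓ₂ h1 h2 h3 h4 (fun z hz => hA z (h5 hz)) fun z hz => hA z (h6 hz)
  rcases exists_leg_or_fork hT hb with
    ⟨u₂, ℓ₂, h₂⟩ | ⟨w, b₁, b₂, u₁, u₂, ℓ₁, ℓ₂, h1, h2, h3, h4, h5, h6⟩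
  swap
  · exact key w b₁ b₂ u₁ u₂ ℓ₁ ℓ₂ h1 h2 h3 h4 (fun z hz => hB z (h5 hz)) fun z hz => hB z (h6 hz)
  refine key c a b u₁ u₂ ℓ₁ ℓ₂ ?_ hab h₁ h₂ hA hB
  by_contra hmaj
  have hcw : c ≠ w := by
    rintro rfl
    exact hmaj hx.1
  obtain ⟨h3, -⟩ := h₁.extend hT hx.1 hmaj
  obtain ⟨d, hd, hwd⟩ := exists_mem_branch hT hcw
  rcases eq_or_eq_of_ncard_eq_two h3 ha hb hab hd with rfl | rfl
  · exact h₁.not_isMajor hT hwd hx.1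
  · exact h₂.not_isMajor hT hwd hx.1

/-- The hypothesis `k ≤ sigma T` says that two legs at `w` have together at least `k` vertices,
which makes the legs long enough for their parts of the generator. -/
theorem exists_isGenerator (hT : T.IsTree) {k : ℕ} (hk : 1 ≤ k) (hks : k ≤ sigma T) :
    ∃ S : Finset V, IsGenerator T k S ∧ S.card = ∑ w, share T k w := by
  classical
  -- One shortest leg at `w` gets `shortShare T k w` vertices, the other legs complete it to `k`.
  have hpick : ∀ w, ∃ q : V → ℕ, (∀ u, IsTerminal T w u → q u ≤ T.dist w u) ∧
      (∀ u v, IsTerminal T w u → IsTerminal T w v → u ≠ v → k ≤ q u + q v) ∧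
      ∑ u ∈ terminals T w, q u = share T k w := by
    intro w
    by_cases hd : 1 < terminalDegree T w
    swap
    · refine ⟨fun _ => 0, fun _ _ => Nat.zero_le _, fun u v hu hv huv => ?_, ?_⟩
      · exact absurd (one_lt_terminalDegree hu hv huv) hd
      · rw [share, if_neg hd, Finset.sum_const_zero]
    have hd' := hd
    rw [terminalDegree_eq] at hd'
    obtain ⟨u, hu⟩ := Finset.card_pos.1 (lt_trans one_pos hd')
    obtain ⟨v, hv, hvl⟩ := exists_shortestLeg (mem_terminals.1 hu)
    refine ⟨fun u => if u = v then shortShare T k w else k - shortShare T k w, ?_, ?_, ?_⟩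
    · intro x hx
      dsimp only
      split_ifs with h
      · subst h
        rw [hvl]
        exact min_le_left _ _
      · have h1 := hks.trans (sigma_le_add hx hv h)
        have h2 := shortestLeg_le hx
        unfold shortShare
        omega
    · intro x y hx hy hxy
      dsimp only
      unfold shortShare
      split_ifs with h1 h2 h2
      · exact absurd (h1.trans h2.symm) hxy
      all_goals omega
    · rw [share, if_pos hd, ← Finset.add_sum_erase _ _ (mem_terminals.2 hv), if_pos rfl,
        Finset.sum_congr rfl (g := fun _ => k - shortShare T k w), Finset.sum_const,
        Finset.card_erase_of_mem (mem_terminals.2 hv), terminalDegree_eq, smul_eq_mul]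
      intro x hx
      rw [if_neg (Finset.ne_of_mem_erase hx)]
  choose q hq1 hq2 hq3 using hpick
  have hsub : ∀ w u, ∃ C : Finset V, IsTerminal T w u →
      (∀ x ∈ C, x ∈ legSet T w u) ∧ C.card = q w u := by
    intro w u
    by_cases h : IsTerminal T w u
    · obtain ⟨C, hC, hcard⟩ := Finset.exists_subset_card_eq
        (s := (legSet T w u).toFinset) (n := q w u) (by
          rw [← Set.ncard_eq_toFinset_card', ncard_legSet hT h]
          exact hq1 w u h)
      exact ⟨C, fun _ => ⟨fun x hx => Set.mem_toFinset.1 (hC hx), hcard⟩⟩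
    · exact ⟨∅, fun h' => absurd h' h⟩
  choose C hC using hsub
  have hdisj := pairwiseDisjoint_of_subset_legSet hT (C := C)
    fun w u hu x hx => (hC w u (mem_terminals.1 hu)).1 x hx
  refine ⟨(Finset.univ.sigma (terminals T)).biUnion fun p => C p.1 p.2, ?_, ?_⟩
  · refine isGenerator_of_two_legs hT (exists_two_terminals hk hks) ?_
    intro w u v D hu hv huv hDu hDv
    have hin : ∀ x, IsTerminal T w x → ∀ z ∈ C w x,
        z ∈ (Finset.univ.sigma (terminals T)).biUnion fun p => C p.1 p.2 := fun x hx z hz =>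
      Finset.mem_biUnion.2 ⟨⟨w, x⟩,
        Finset.mem_sigma.2 ⟨Finset.mem_univ _, mem_terminals.2 hx⟩, hz⟩
    have hd : Disjoint (C w u) (C w v) := Finset.disjoint_left.2 fun z hz hz' =>
      huv (legSet_unique hT hu.1 hv.1 ((hC w u hu).1 z hz) ((hC w v hv).1 z hz')).2
    refine (hq2 w u v hu hv huv).trans ?_
    rw [← (hC w u hu).2, ← (hC w v hv).2, ← Finset.card_union_of_disjoint hd]
    refine Finset.card_le_card (Finset.union_subset ?_ ?_)
    · exact fun z hz => hDu z (hin u hu z hz) ((hC w u hu).1 z hz)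
    · exact fun z hz => hDv z (hin v hv z hz) ((hC w v hv).1 z hz)
  · rw [Finset.card_biUnion hdisj, Finset.sum_sigma]
    refine Finset.sum_congr rfl fun w _ => ?_
    rw [← hq3 w]
    exact Finset.sum_congr rfl fun u hu => (hC w u (mem_terminals.1 hu)).2

theorem isDimension_sum_share (hT : T.IsTree) {k : ℕ} (hk : 1 ≤ k) (hks : k ≤ sigma T) :
    IsDimension T k (∑ w, share T k w) := by
  refine ⟨exists_isGenerator hT hk hks, ?_⟩
  rintro _ ⟨S, hS, rfl⟩
  exact sum_share_le_card hT hS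

end Dimension

/-! ### Reasoning about programs -/

section Machine

/-- The program `p` started in the state `s` halts, after a number of steps and in a state that
satisfy `Q`. -/
def Runs (W : ℕ) (p : Program) (s : State) (Q : ℕ → State → Prop) : Prop :=
  ∃ t s', Exec W p s t s' ∧ Q t s'

variable {W : ℕ} {s : State} {Q : ℕ → State → Prop}

theorem Runs.mono {p : Program} {Q' : ℕ → State → Prop} (h : Runs W p s Q)
    (hQ : ∀ t s', Q t s' → Q' t s') : Runs W p s Q' := by
  obtain ⟨t, s', he, hq⟩ := h
  exact ⟨t, s', he, hQ t s' hq⟩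

theorem runs_instr {i : Instr} :
    Runs W (.instr i) s Q ↔ i.value s ≤ W ∧ Q 1 (i.apply s) := by
  constructor
  · rintro ⟨t, s', he, hq⟩
    cases he with
    | instr _ _ h => exact ⟨h, hq⟩
  · exact fun ⟨h, hq⟩ => ⟨1, _, .instr i s h, hq⟩

theorem runs_skip : Runs W .skip s Q ↔ Q 1 s := by
  constructor
  · rintro ⟨t, s', he, hq⟩
    cases he
    exact hq
  · exact fun hq => ⟨1, _, .skip s, hq⟩

theorem runs_seq {p q : Program} :
    Runs W (.seq p q) s Q ↔
      Runs W p s fun t₁ s₁ => Runs W q s₁ fun t₂ s₂ => Q (t₁ + t₂) s₂ := by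
  constructor
  · rintro ⟨t, s', he, hq⟩
    cases he with
    | seq h₁ h₂ => exact ⟨_, _, h₁, _, _, h₂, hq⟩
  · rintro ⟨t₁, s₁, h₁, t₂, s₂, h₂, hq⟩
    exact ⟨_, _, .seq h₁ h₂, hq⟩

theorem Runs.ite_of_ne {r : ℕ} {p q : Program} (hr : s.reg r ≠ 0)
    (h : Runs W p s fun t s' => Q (t + 1) s') : Runs W (.ite r p q) s Q := by
  obtain ⟨t, s', he, hq⟩ := h
  exact ⟨_, _, .iteTrue hr he, hq⟩

theorem Runs.ite_of_eq {r : ℕ} {p q : Program} (hr : s.reg r = 0)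
    (h : Runs W q s fun t s' => Q (t + 1) s') : Runs W (.ite r p q) s Q := by
  obtain ⟨t, s', he, hq⟩ := h
  exact ⟨_, _, .iteFalse hr he, hq⟩

/-- The rule for loops. The invariant `I j t s` relates the variant `j`, which decreases in each
round, the number `t` of the steps made so far, and the state. -/
theorem Runs.loop {r : ℕ} {p : Program} {j : ℕ} (I : ℕ → ℕ → State → Prop)
    (step : ∀ j t s, I j t s → s.reg r ≠ 0 →
      Runs W p s fun t' s' => ∃ j' < j, I j' (t + t' + 1) s')
    (done : ∀ j t s, I j t s → s.reg r = 0 → Q (t + 1) s)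
    (init : I j 0 s) : Runs W (.loop r p) s Q := by
  have main : ∀ j t₀ s, I j t₀ s → ∃ t s', Exec W (.loop r p) s t s' ∧ Q (t₀ + t) s' := by
    intro j
    induction j using Nat.strong_induction_on with
    | _ j ih =>
    intro t₀ s hI
    by_cases hr : s.reg r = 0
    · exact ⟨1, s, .loopDone hr, done j t₀ s hI hr⟩
    · obtain ⟨t₁, s₁, h₁, j', hj', hI'⟩ := step j t₀ s hI hr
      obtain ⟨t₂, s₂, h₂, hq⟩ := ih j' hj' _ s₁ hI'
      refine ⟨_, _, .loopStep hr h₁ h₂, ?_⟩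
      rwa [show t₀ + (t₁ + t₂ + 1) = t₀ + t₁ + 1 + t₂ by ring]
  obtain ⟨t, s', he, hq⟩ := main j 0 s init
  rw [zero_add] at hq
  exact ⟨t, s', he, hq⟩

/-- The registers that hold the entries of the list `l`, and `0` beyond it. -/
def regs (l : List ℕ) : ℕ → ℕ := fun r => l.getD r 0

theorem regs_apply (l : List ℕ) (r : ℕ) : regs l r = l.getD r 0 := rfl

theorem update_regs {l : List ℕ} {r x : ℕ} (h : r < l.length) :
    Function.update (regs l) r x = regs (l.set r x) := by
  funext i
  by_cases hi : i = r
  · subst hi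
    simp [regs_apply, h]
  · simp [regs_apply, Function.update_of_ne hi, List.getElem?_set_ne (Ne.symm hi)]

/-- The instructions `l` one after the other, followed by `q`. -/
def Program.block (l : List Instr) (q : Program) : Program :=
  l.foldr (fun i p => .seq (.instr i) p) q

theorem runs_block_nil {q : Program} : Runs W (.block [] q) s Q ↔ Runs W q s Q := Iff.rfl

theorem runs_block_cons {i : Instr} {l : List Instr} {q : Program} :
    Runs W (.block (i :: l) q) s Q ↔
      i.value s ≤ W ∧ Runs W (.block l q) (i.apply s) fun t s' => Q (1 + t) s' :=
  runs_seq.trans runs_instr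

/-- The memory cells from the address `b` on hold the values of `f`. -/
def Table {n : ℕ} (M : ℕ → ℕ) (b : ℕ) (f : Fin n → ℕ) : Prop :=
  ∀ v : Fin n, M (b + v) = f v

theorem Table.update_self {n b : ℕ} {M : ℕ → ℕ} {f : Fin n → ℕ} (h : Table M b f) (v : Fin n)
    (x : ℕ) : Table (Function.update M (b + v) x) b (Function.update f v x) := by
  intro u
  by_cases hu : u = v
  · subst hu
    simp
  · have : b + (u : ℕ) ≠ b + v := fun h => hu (Fin.ext (by omega))
    rw [Function.update_of_ne this, Function.update_of_ne hu, h u]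

theorem Table.update_of_ne {n b : ℕ} {M : ℕ → ℕ} {f : Fin n → ℕ} (h : Table M b f) {a x : ℕ}
    (ha : a < b ∨ b + n ≤ a) : Table (Function.update M a x) b f := by
  intro u
  have := u.isLt
  rw [Function.update_of_ne (by omega), h u]

/-- The program that adds the register `c` to the memory cell whose address is the sum of the
registers `a` and `b`, and then goes on with `q`. It uses the registers 9 and 12. -/
def bump (a b c : ℕ) (q : Program) : Program :=
  .block [.add 9 a b, .load 12 9, .add 12 12 c, .store 9 12] q

theorem runs_bump {n b x ra rb rc : ℕ} {l : List ℕ} {M : ℕ → ℕ} {f : Fin n → ℕ} {v : Fin n}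
    {q : Program} (hf : Table M b f) (hl : 12 < l.length) (h9 : rc ≠ 9) (h12 : rc ≠ 12)
    (ha : l.getD ra 0 = b) (hb : l.getD rb 0 = v) (hc : l.getD rc 0 = x)
    (hW : b + v ≤ W) (hW' : f v + x ≤ W)
    (hq : Runs W q ⟨regs ((l.set 9 (b + v)).set 12 (f v + x)),
      Function.update M (b + v) (f v + x)⟩ fun t s' => Q (4 + t) s') :
    Runs W (bump ra rb rc q) ⟨regs l, M⟩ Q := by
  have h1 : 9 < l.length := by omega
  have h2 : M (b + v) = f v := hf v
  have e1 : ((l.set 9 (b + v)).set 12 (f v)).getD 12 0 = f v := by simp [hl]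
  have e2 : ((l.set 9 (b + v)).set 12 (f v)).getD rc 0 = x := by
    rw [← hc]
    simp [List.getElem?_set_ne h9.symm, List.getElem?_set_ne h12.symm]
  have e3 : (l.set 9 (b + v)).getD 9 0 = b + v := by simp [h1]
  have e4 : ((l.set 9 (b + v)).set 12 (f v + x)).getD 9 0 = b + v := by simp [h1]
  have e5 : ((l.set 9 (b + v)).set 12 (f v + x)).getD 12 0 = f v + x := by simp [hl]
  simp only [bump, runs_block_cons, runs_block_nil, Instr.value, Instr.apply, regs_apply, ha, hb,
    update_regs h1, e3, h2, update_regs (show 12 < (l.set 9 (b + v)).length by simpa), e1, e2,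
    update_regs (show 12 < ((l.set 9 (b + v)).set 12 (f v)).length by simpa), List.set_set, e4, e5]
  refine ⟨hW, by omega, hW', hW', ?_⟩
  exact hq.mono fun t s' h => by convert h using 1; omega

end Machine

/-! ### Tabulating degrees and sums of neighbours -/

section Edges

variable {n : ℕ}

/-- The contribution of an edge to the sum of `f` over the neighbours of `v`. -/
def contrib (f : Fin n → ℕ) (v : Fin n) (e : Fin n × Fin n) : ℕ :=
  (if e.1 = v then f e.2 else 0) + (if e.2 = v then f e.1 else 0)

/-- The sum of `f` over the neighbours of `v`, with respect to a list of edges. -/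
def edgeSum (f : Fin n → ℕ) (L : List (Fin n × Fin n)) (v : Fin n) : ℕ :=
  (L.map (contrib f v)).sum

open Classical in
/-- The sum of `f` over the neighbours of `v`. -/
noncomputable def nbSum (T : SimpleGraph (Fin n)) (f : Fin n → ℕ) (v : Fin n) : ℕ :=
  ∑ x, if T.Adj v x then f x else 0

theorem edgeSum_cons (f : Fin n → ℕ) (e : Fin n × Fin n) (L : List (Fin n × Fin n)) (v : Fin n) :
    edgeSum f (e :: L) v = contrib f v e + edgeSum f L v := rfl

theorem contrib_eq_sum (f : Fin n → ℕ) (v : Fin n) {e : Fin n × Fin n} (he : e.1 ≠ e.2) :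
    contrib f v e = ∑ x, if s(v, x) = s(e.1, e.2) then f x else 0 := by
  obtain ⟨a, b⟩ := e
  dsimp only at he
  have h : ∀ x, (if s(v, x) = s(a, b) then f x else 0) =
      (if b = x then (if a = v then f x else 0) else 0) +
        (if a = x then (if b = v then f x else 0) else 0) := by
    intro x
    simp only [Sym2.eq_iff]
    by_cases h1 : b = x <;> by_cases h2 : a = x <;> by_cases h3 : a = v <;> by_cases h4 : b = v <;>
      simp_all [eq_comm]
  simp only [contrib, h, Finset.sum_add_distrib, Finset.sum_ite_eq, Finset.mem_univ, if_true]

theorem edgeSum_eq_sum (f : Fin n → ℕ) (v : Fin n) {L : List (Fin n × Fin n)}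
    (hnd : (L.map fun e => s(e.1, e.2)).Nodup) (hne : ∀ e ∈ L, e.1 ≠ e.2) :
    edgeSum f L v = ∑ x, if s(v, x) ∈ L.map (fun e => s(e.1, e.2)) then f x else 0 := by
  induction L with
  | nil => simp [edgeSum]
  | cons e L ih =>
    rw [List.map_cons, List.nodup_cons] at hnd
    rw [edgeSum_cons, contrib_eq_sum f v (hne e (by simp)),
      ih hnd.2 fun e' he' => hne e' (by simp [he']), ← Finset.sum_add_distrib]
    refine Finset.sum_congr rfl fun x _ => ?_
    simp only [List.map_cons, List.mem_cons]
    by_cases h1 : s(v, x) = s(e.1, e.2)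
    · have h2 := hnd.1
      rw [← h1] at h2
      rw [if_pos h1, if_neg h2, if_pos (Or.inl h1), add_zero]
    · by_cases h2 : s(v, x) ∈ L.map fun e => s(e.1, e.2)
      · rw [if_neg h1, if_pos h2, if_pos (Or.inr h2), zero_add]
      · rw [if_neg h1, if_neg h2, if_neg (not_or.2 ⟨h1, h2⟩)]

theorem IsEdgeList.edgeSum_eq {T : SimpleGraph (Fin n)} {L : List (Fin n × Fin n)}
    (h : IsEdgeList T L) (f : Fin n → ℕ) : edgeSum f L = nbSum T f := by
  classical
  funext v
  rw [edgeSum_eq_sum f v h.1, nbSum]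
  · refine Finset.sum_congr rfl fun x _ => ?_
    have := h.2 s(v, x)
    rw [SimpleGraph.mem_edgeSet] at this
    exact if_congr this rfl rfl
  · intro e he
    have := (h.2 s(e.1, e.2)).1 (List.mem_map.2 ⟨e, he, rfl⟩)
    rw [SimpleGraph.mem_edgeSet] at this
    exact this.ne

theorem IsEdgeList.length_add_one {T : SimpleGraph (Fin n)} {L : List (Fin n × Fin n)}
    (h : IsEdgeList T L) (hT : T.IsTree) : L.length + 1 = n := by
  classical
  have h1 : (L.map fun e => s(e.1, e.2)).toFinset = T.edgeFinset := by
    ext e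
    rw [List.mem_toFinset, h.2 e, SimpleGraph.mem_edgeFinset]
  have h2 := hT.card_edgeFinset
  rwa [← h1, List.toFinset_card_of_nodup h.1, List.length_map, Fintype.card_fin] at h2

theorem nbSum_one (T : SimpleGraph (Fin n)) (v : Fin n) :
    nbSum T (fun _ => 1) v = (T.neighborSet v).ncard := by
  classical
  rw [nbSum, ← Finset.card_filter, ← Set.ncard_coe_finset]
  congr 1
  ext x
  simp

theorem nbSum_of_isLeaf {T : SimpleGraph (Fin n)} {u c : Fin n} (hu : IsLeaf T u)
    (hc : T.Adj u c) (f : Fin n → ℕ) : nbSum T f u = f c := by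
  classical
  rw [nbSum, Finset.sum_eq_single c, if_pos hc]
  · intro x _ hx
    exact if_neg fun h => hx (eq_of_isLeaf hu h hc)
  · simp

theorem nbSum_of_ncard_eq_two {T : SimpleGraph (Fin n)} {c a b : Fin n}
    (h : (T.neighborSet c).ncard = 2) (ha : T.Adj c a) (hb : T.Adj c b) (hab : a ≠ b)
    (f : Fin n → ℕ) : nbSum T f c = f a + f b := by
  classical
  rw [nbSum, ← Finset.sum_pair hab, ← Finset.sum_subset (Finset.subset_univ {a, b})]
  · refine Finset.sum_congr rfl fun x hx => if_pos ?_
    rcases Finset.mem_insert.1 hx with rfl | hx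
    · exact ha
    · rwa [Finset.mem_singleton.1 hx]
  · intro x _ hx
    refine if_neg fun hadj => hx ?_
    rcases eq_or_eq_of_ncard_eq_two h ha hb hab hadj with rfl | rfl <;> simp

theorem nbSum_le (T : SimpleGraph (Fin n)) {f : Fin n → ℕ} {m : ℕ} (hf : ∀ x, f x ≤ m)
    (v : Fin n) : nbSum T f v ≤ n * m := by
  classical
  refine (Finset.sum_le_card_nsmul _ _ m fun x _ => ?_).trans (by simp)
  split_ifs
  · exact hf x
  · exact Nat.zero_le m

theorem edgeSum_le {f : Fin n → ℕ} {m : ℕ} (hf : ∀ x, f x ≤ m) (L : List (Fin n × Fin n))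
    (v : Fin n) : edgeSum f L v ≤ 2 * m * L.length := by
  induction L with
  | nil => simp [edgeSum]
  | cons e L ih =>
    rw [edgeSum_cons, List.length_cons, Nat.mul_succ]
    have h1 := hf e.1
    have h2 := hf e.2
    unfold contrib
    split_ifs <;> omega

theorem update_edgeSum (f : Fin n → ℕ) (e : Fin n × Fin n) (L : List (Fin n × Fin n)) :
    Function.update (Function.update (edgeSum f L) e.1 (edgeSum f L e.1 + f e.2)) e.2
      (Function.update (edgeSum f L) e.1 (edgeSum f L e.1 + f e.2) e.2 + f e.1) =
      edgeSum f (e :: L) := by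
  funext v
  rw [edgeSum_cons, contrib]
  by_cases h1 : e.1 = v <;> by_cases h2 : e.2 = v
  · subst h1
    rw [h2]
    simp
    omega
  · subst h1
    rw [Function.update_of_ne (Ne.symm h2)]
    simp [h2, add_comm]
  · subst h2
    rw [Function.update_self, Function.update_of_ne (Ne.symm h1)]
    simp [h1, add_comm]
  · rw [Function.update_of_ne (Ne.symm h2), Function.update_of_ne (Ne.symm h1)]
    simp [h1, h2]

/-- The endpoints of the edge number `i` are the entries `2 * i` and `2 * i + 1` of the input. -/
theorem getD_flatMap_pair (L : List (Fin n × Fin n)) {i : ℕ} (hi : i < L.length) :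
    (L.flatMap fun e => [(e.1 : ℕ), (e.2 : ℕ)]).getD (2 * i) 0 = L[i].1 ∧
      (L.flatMap fun e => [(e.1 : ℕ), (e.2 : ℕ)]).getD (2 * i + 1) 0 = L[i].2 := by
  induction L generalizing i with
  | nil => simp at hi
  | cons e L ih =>
    cases i with
    | zero => simp
    | succ i =>
      rw [List.length_cons, Nat.add_lt_add_iff_right] at hi
      exact ih hi

theorem getD_flatMap_pair_of_le (L : List (Fin n × Fin n)) {a : ℕ} (ha : 2 * L.length ≤ a) :
    (L.flatMap fun e => [(e.1 : ℕ), (e.2 : ℕ)]).getD a 0 = 0 := by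
  refine List.getD_eq_default _ _ ?_
  simpa [List.length_flatMap, mul_comm] using ha

/-- For the edge number `i - 1`, where the register 7 holds `i`, update the table of degrees, whose
address is in the register 3, and the table of sums of neighbours, whose address is in the
register 4. -/
def edgeStep : Program :=
  .block [.sub 7 7 2, .add 9 7 7, .load 10 9, .add 9 9 2, .load 11 9]
    (bump 3 10 2 (bump 3 11 2 (bump 4 10 11 (bump 4 11 10 .skip))))

theorem runs_edgeStep {W k i x₉ x₁₀ x₁₁ x₁₂ : ℕ} {M : ℕ → ℕ} {L : List (Fin n × Fin n)}
    {e : Fin n × Fin n} {Q : ℕ → State → Prop} (hW : 10 * (n * n) + 10 * n ≤ W)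
    (hi : i < n) (hL : L.length ≤ n) (ha : M (2 * i) = e.1) (hb : M (2 * i + 1) = e.2)
    (hdeg : Table M (2 * n) (edgeSum (fun _ => 1) L))
    (hsum : Table M (3 * n) (edgeSum (fun v => (v : ℕ)) L))
    (hQ : ∀ t M' x₉ x₁₀ x₁₁ x₁₂, t ≤ 22 →
      Table M' (2 * n) (edgeSum (fun _ => 1) (e :: L)) →
      Table M' (3 * n) (edgeSum (fun v => (v : ℕ)) (e :: L)) →
      (∀ a, a < 2 * n ∨ 4 * n ≤ a → M' a = M a) →
      Q t ⟨regs [n, k, 1, 2 * n, 3 * n, 4 * n, 5 * n, i, 0, x₉, x₁₀, x₁₁, x₁₂, 0, 0], M'⟩) :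
    Runs W edgeStep
      ⟨regs [n, k, 1, 2 * n, 3 * n, 4 * n, 5 * n, i + 1, 0, x₉, x₁₀, x₁₁, x₁₂, 0, 0], M⟩ Q := by
  have hdle : ∀ v, edgeSum (fun _ => 1) L v ≤ 2 * n := fun v =>
    (edgeSum_le (fun _ => le_rfl) _ v).trans (by omega)
  have hsle : ∀ v, edgeSum (fun v => (v : ℕ)) L v ≤ 2 * (n * n) := fun v =>
    (edgeSum_le (fun x => x.isLt.le) _ v).trans (by
      rw [mul_assoc]
      exact Nat.mul_le_mul_left _ (Nat.mul_le_mul_left _ hL))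
  have hv1 := e.1.isLt
  have hv2 := e.2.isLt
  have hup := hdle e.1
  have hup₂ := hsle e.1
  have hup' : Function.update (edgeSum (fun _ => 1) L) e.1 (edgeSum (fun _ => 1) L e.1 + 1) e.2 ≤
      2 * n + 1 := by
    have := hdle e.2
    rw [Function.update_apply]
    split_ifs <;> omega
  have hup₂' : Function.update (edgeSum (fun v => (v : ℕ)) L) e.1
      (edgeSum (fun v => (v : ℕ)) L e.1 + e.2) e.2 ≤ 2 * (n * n) + n := by
    have := hsle e.2
    rw [Function.update_apply]
    split_ifs <;> omega
  simp only [edgeStep, runs_block_cons, runs_block_nil, Instr.value, Instr.apply]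
  simp only [update_regs, regs_apply, List.set_cons_succ, List.set_cons_zero, List.length_cons,
    List.length_nil, List.getD_cons_succ, List.getD_cons_zero, Nat.reduceAdd, Nat.reduceLT,
    Nat.add_sub_cancel]
  simp only [← two_mul, ha, hb]
  refine ⟨by omega, by omega, by omega, by omega, by omega, ?_⟩
  have hdeg₁ := hdeg.update_self e.1 (edgeSum (fun _ => 1) L e.1 + 1)
  have hdeg₂ := hdeg₁.update_self e.2
    (Function.update (edgeSum (fun _ => 1) L) e.1 (edgeSum (fun _ => 1) L e.1 + 1) e.2 + 1)
  have hsum₀ := (hsum.update_of_ne (a := 2 * n + (e.1 : ℕ))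
    (x := edgeSum (fun _ => 1) L e.1 + 1) (by omega)).update_of_ne (a := 2 * n + (e.2 : ℕ))
    (x := Function.update (edgeSum (fun _ => 1) L) e.1 (edgeSum (fun _ => 1) L e.1 + 1) e.2 + 1)
    (by omega)
  have hsum₁ := hsum₀.update_self e.1 (edgeSum (fun v => (v : ℕ)) L e.1 + e.2)
  refine runs_bump hdeg (v := e.1) (x := 1) (by simp) (by decide) (by decide) rfl rfl rfl
    (by omega) (by omega) ?_
  refine runs_bump hdeg₁ (v := e.2) (x := 1) (by simp) (by decide) (by decide) rfl rfl rfl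
    (by omega) (by omega) ?_
  refine runs_bump hsum₀ (v := e.1) (x := e.2) (by simp) (by decide) (by decide) rfl rfl rfl
    (by omega) (by omega) ?_
  refine runs_bump hsum₁ (v := e.2) (x := e.1) (by simp) (by decide) (by decide) rfl rfl rfl
    (by omega) (by omega) ?_
  rw [runs_skip]
  refine hQ _ _ _ _ _ _ (by omega) ?_ ?_ ?_
  · rw [← update_edgeSum]
    exact (hdeg₂.update_of_ne (by omega)).update_of_ne (by omega)
  · rw [← update_edgeSum]
    exact hsum₁.update_self e.2 _
  · intro a ha
    repeat rw [Function.update_of_ne (by omega)]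

theorem runs_edges {W k : ℕ} {M : ℕ → ℕ} {L : List (Fin n × Fin n)}
    {Q : ℕ → State → Prop} (hW : 10 * (n * n) + 10 * n ≤ W) (hL : L.length + 1 = n)
    (hM : ∀ a, M a = (L.flatMap fun e => [(e.1 : ℕ), (e.2 : ℕ)]).getD a 0)
    (hQ : ∀ t M x₉ x₁₀ x₁₁ x₁₂, t ≤ 23 * n →
      Table M (2 * n) (edgeSum (fun _ => 1) L) → Table M (3 * n) (edgeSum (fun v => (v : ℕ)) L) →
      Table M (4 * n) (fun _ : Fin n => 0) → Table M (5 * n) (fun _ : Fin n => 0) →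
      Q t ⟨regs [n, k, 1, 2 * n, 3 * n, 4 * n, 5 * n, 0, 0, x₉, x₁₀, x₁₁, x₁₂, 0, 0], M⟩) :
    Runs W (.loop 7 edgeStep)
      ⟨regs [n, k, 1, 2 * n, 3 * n, 4 * n, 5 * n, L.length, 0, 0, 0, 0, 0, 0, 0], M⟩ Q := by
  refine Runs.loop (j := L.length) (fun j t s => ∃ M x₉ x₁₀ x₁₁ x₁₂,
    s = ⟨regs [n, k, 1, 2 * n, 3 * n, 4 * n, 5 * n, j, 0, x₉, x₁₀, x₁₁, x₁₂, 0, 0], M⟩ ∧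
    j ≤ L.length ∧ t + 23 * j ≤ 23 * L.length ∧
    (∀ i (h : i < L.length), M (2 * i) = L[i].1 ∧ M (2 * i + 1) = L[i].2) ∧
    Table M (2 * n) (edgeSum (fun _ => 1) (L.drop j)) ∧
    Table M (3 * n) (edgeSum (fun v => (v : ℕ)) (L.drop j)) ∧
    Table M (4 * n) (fun _ : Fin n => 0) ∧ Table M (5 * n) (fun _ : Fin n => 0)) ?_ ?_ ?_
  · rintro j t _ ⟨M, x₉, x₁₀, x₁₁, x₁₂, rfl, hj, ht, hin, hdeg, hsum, hter, hbest⟩ hr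
    replace hr : j ≠ 0 := by simpa [regs_apply] using hr
    obtain ⟨i, rfl⟩ := Nat.exists_eq_succ_of_ne_zero hr
    rw [Nat.succ_eq_add_one] at *
    have hi : i < L.length := by omega
    obtain ⟨ha, hb⟩ := hin i hi
    have hdrop : L.drop i = L[i] :: L.drop (i + 1) := List.drop_eq_getElem_cons hi
    refine runs_edgeStep hW (by omega) (by rw [List.length_drop]; omega) ha hb hdeg hsum ?_
    intro t' M' x₉ x₁₀ x₁₁ x₁₂ ht' hdeg' hsum' hM'
    rw [← hdrop] at hdeg' hsum'
    refine ⟨i, Nat.lt_succ_self i, M', x₉, x₁₀, x₁₁, x₁₂, rfl, by omega, by omega, ?_, hdeg',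
      hsum', ?_, ?_⟩
    · intro i' hi'
      rw [hM' _ (by omega), hM' _ (by omega)]
      exact hin i' hi'
    · exact fun v => (hM' _ (by omega)).trans (hter v)
    · exact fun v => (hM' _ (by omega)).trans (hbest v)
  · rintro j t _ ⟨M, x₉, x₁₀, x₁₁, x₁₂, rfl, hj, ht, hin, hdeg, hsum, hter, hbest⟩ hr
    replace hr : j = 0 := by simpa [regs_apply] using hr
    subst hr
    exact hQ _ _ _ _ _ _ (by omega) hdeg hsum hter hbest
  · refine ⟨M, 0, 0, 0, 0, rfl, le_rfl, by omega, fun i hi => ?_, ?_, ?_, ?_, ?_⟩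
    · rw [hM, hM]
      exact getD_flatMap_pair L hi
    · intro v
      rw [hM, getD_flatMap_pair_of_le L (by omega), List.drop_length]
      rfl
    · intro v
      rw [hM, getD_flatMap_pair_of_le L (by omega), List.drop_length]
      rfl
    · exact fun v => (hM _).trans (getD_flatMap_pair_of_le L (by omega))
    · exact fun v => (hM _).trans (getD_flatMap_pair_of_le L (by omega))

end Edges

/-! ### Climbing from the leaves to the major vertices -/

section Climb

variable {n : ℕ} {T : SimpleGraph (Fin n)}

/-- One step from the vertex in the register 11 away from the vertex in the register 10. The
register 13 counts the steps, and the register 12 is zero at a vertex of degree at least three. -/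
def climbStep : Program :=
  .block [.add 9 4 11, .load 9 9, .sub 9 9 10, .move 10 11, .move 11 9, .add 13 13 2,
    .add 9 3 11, .load 9 9, .sub 12 14 9] .skip

/-- The climb from the leaf `u` keeps to the leg of `u`: the next vertex is the sum of the
neighbours of the current vertex minus the previous vertex. The time is proportional to the length
of the leg. -/
theorem runs_climb (hT : T.IsTree) {m : Fin n} (hm : IsMajor T m) {W k i x₈ x₉ ℓ : ℕ}
    {M : ℕ → ℕ} {c a u : Fin n} {Q : ℕ → State → Prop} (hW : 10 * (n * n) + 10 * n ≤ W)
    (hdeg : Table M (2 * n) (nbSum T fun _ => 1))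
    (hsum : Table M (3 * n) (nbSum T fun v => (v : ℕ))) (hl : Leg T c a u ℓ)
    (hQ : ∀ t w b ℓ' x₉, IsMajor T w → Leg T w b u ℓ' → t + 11 * ℓ ≤ 11 * ℓ' + 1 →
      Q t ⟨regs [n, k, 1, 2 * n, 3 * n, 4 * n, 5 * n, i, x₈, x₉, b, w, 0, ℓ', 3], M⟩) :
    Runs W (.loop 12 climbStep)
      ⟨regs [n, k, 1, 2 * n, 3 * n, 4 * n, 5 * n, i, x₈, x₉, a, c,
        3 - nbSum T (fun _ => 1) c, ℓ, 3], M⟩ Q := by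
  refine Runs.loop (j := n - ℓ) (fun j t s => ∃ (c a : Fin n) (x₉ ℓ' : ℕ),
    s = ⟨regs [n, k, 1, 2 * n, 3 * n, 4 * n, 5 * n, i, x₈, x₉, a, c,
        3 - nbSum T (fun _ => 1) c, ℓ', 3], M⟩ ∧
    Leg T c a u ℓ' ∧ j = n - ℓ' ∧ t + 11 * ℓ ≤ 11 * ℓ') ?_ ?_ ?_
  · rintro j t _ ⟨c, a, x₉, ℓ', rfl, hl', rfl, ht⟩ hr
    replace hr : 3 - nbSum T (fun _ => 1) c ≠ 0 := hr
    rw [nbSum_one] at hr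
    have hc : ¬ IsMajor T c := by
      unfold IsMajor
      omega
    -- The centre has degree two, since a leg that ends at a vertex of degree one is the whole tree.
    obtain ⟨h2, d, hcd, hda, hl₂⟩ := hl'.extend hT hm hc
    have hlt := hl₂.length_lt hT
    rw [Nat.card_fin] at hlt
    have hsc : M (3 * n + c) = a + d :=
      (hsum c).trans (nbSum_of_ncard_eq_two h2 hl'.adj hcd hda.symm _)
    have hdd := hdeg d
    have hdle : nbSum T (fun _ => 1) d ≤ n * 1 := nbSum_le T (fun _ => le_rfl) d
    have hc' := c.isLt
    have ha' := a.isLt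
    have hd' := d.isLt
    simp only [climbStep, runs_block_cons, runs_block_nil, runs_skip, Instr.value, Instr.apply]
    simp only [update_regs, regs_apply, List.set_cons_succ, List.set_cons_zero, List.length_cons,
      List.length_nil, List.getD_cons_succ, List.getD_cons_zero, Nat.reduceAdd, Nat.reduceLT,
      hsc, Nat.add_sub_cancel_left, hdd]
    refine ⟨by omega, by omega, by omega, by omega, by omega, by omega, by omega, by omega,
      by omega, n - (ℓ' + 1), by omega, d, c, _, ℓ' + 1, rfl, hl₂, rfl, by omega⟩
  · rintro j t _ ⟨c, a, x₉, ℓ', rfl, hl', rfl, ht⟩ hr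
    replace hr : 3 - nbSum T (fun _ => 1) c = 0 := hr
    rw [hr]
    rw [nbSum_one] at hr
    refine hQ _ _ _ _ _ ?_ hl' (by omega)
    unfold IsMajor
    omega
  · exact ⟨c, a, x₉, ℓ, rfl, hl, rfl, by omega⟩

/-- From the leaf in the register 7, climb to its major vertex `w` and record the leaf there: the
table of terminal degrees, whose address is in the register 5, counts one more, and the table whose
address is in the register 6 keeps the maximum of `n` minus the distance to `w`. -/
def leafStep : Program :=
  .block [.move 10 7, .add 9 4 10, .load 11 9, .move 13 2, .const 14 3, .add 9 3 11, .load 9 9,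
    .sub 12 14 9]
    (.seq (.loop 12 climbStep)
      (bump 5 11 2 (.block [.sub 10 0 13, .add 9 6 11, .load 12 9, .sub 10 10 12]
        (bump 6 11 10 .skip))))

theorem runs_leafStep (hT : T.IsTree) {m : Fin n} (hm : IsMajor T m)
    {W k x₉ x₁₀ x₁₁ x₁₂ x₁₃ x₁₄ : ℕ} {M : ℕ → ℕ} {u : Fin n} {Q : ℕ → State → Prop}
    {ter best : Fin n → ℕ}
    (hW : 10 * (n * n) + 10 * n ≤ W) (hu : IsLeaf T u)
    (hdeg : Table M (2 * n) (nbSum T fun _ => 1))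
    (hsum : Table M (3 * n) (nbSum T fun v => (v : ℕ)))
    (hter : Table M (4 * n) ter) (hbest : Table M (5 * n) best)
    (hter_le : ∀ v, ter v ≤ n) (hbest_le : ∀ v, best v ≤ n)
    (hQ : ∀ t w M' x₉ x₁₀ x₁₁ x₁₂ x₁₃ x₁₄, IsTerminal T w u → t ≤ 11 * T.dist w u + 11 →
      Table M' (2 * n) (nbSum T fun _ => 1) → Table M' (3 * n) (nbSum T fun v => (v : ℕ)) →
      Table M' (4 * n) (Function.update ter w (ter w + 1)) →
      Table M' (5 * n) (Function.update best w (max (best w) (n - T.dist w u))) →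
      Q t ⟨regs [n, k, 1, 2 * n, 3 * n, 4 * n, 5 * n, u, 0, x₉, x₁₀, x₁₁, x₁₂, x₁₃, x₁₄], M'⟩) :
    Runs W leafStep
      ⟨regs [n, k, 1, 2 * n, 3 * n, 4 * n, 5 * n, u, 0, x₉, x₁₀, x₁₁, x₁₂, x₁₃, x₁₄], M⟩ Q := by
  obtain ⟨c, hc⟩ := Set.ncard_eq_one.1 hu
  have hadj : T.Adj u c := by
    have : c ∈ T.neighborSet u := hc ▸ rfl
    exact this
  have hsu : M (3 * n + u) = c := (hsum u).trans (nbSum_of_isLeaf hu hadj _)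
  have hdc := hdeg c
  have hdle : nbSum T (fun _ => 1) c ≤ n * 1 := nbSum_le T (fun _ => le_rfl) c
  have hc' := c.isLt
  have hu' := u.isLt
  simp only [leafStep, runs_block_cons, runs_block_nil, Instr.value, Instr.apply]
  simp only [update_regs, regs_apply, List.set_cons_succ, List.set_cons_zero, List.length_cons,
    List.length_nil, List.getD_cons_succ, List.getD_cons_zero, Nat.reduceAdd, Nat.reduceLT,
    hsu, hdc]
  have hcu : (c : ℕ) ≠ u := fun h => hadj.ne (Fin.ext h).symm
  refine ⟨by omega, by omega, by omega, by omega, by omega, by omega, by omega, by omega, ?_⟩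
  rw [runs_seq]
  refine runs_climb hT hm hW hdeg hsum (.leaf hadj.symm hu) fun t w b ℓ x₉ hw hl ht => ?_
  have hlt := hl.length_lt hT
  rw [Nat.card_fin] at hlt
  have hdist := hl.dist_eq hT
  have hw' := w.isLt
  have h1 := hter_le w
  have h2 := hbest_le w
  refine runs_bump hter (v := w) (x := 1) (by simp) (by decide) (by decide) rfl rfl rfl
    (by omega) (by omega) ?_
  have hbest₁ := hbest.update_of_ne (a := 4 * n + w) (x := ter w + 1) (by omega)
  have hbw := hbest₁ w
  simp only [runs_block_cons, runs_block_nil, Instr.value, Instr.apply]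
  simp only [update_regs, regs_apply, List.set_cons_succ, List.set_cons_zero, List.length_cons,
    List.length_nil, List.getD_cons_succ, List.getD_cons_zero, Nat.reduceAdd, Nat.reduceLT, hbw]
  refine ⟨by omega, by omega, by omega, by omega, ?_⟩
  refine runs_bump hbest₁ (v := w) (x := n - ℓ - best w) (by simp) (by decide) (by decide)
    rfl rfl rfl (by omega) (by omega) ?_
  rw [runs_skip]
  refine hQ _ w _ _ _ _ _ _ _ (hl.isTerminal hT hw) (by omega) ?_ ?_ ?_ ?_
  · exact (hdeg.update_of_ne (by omega)).update_of_ne (by omega)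
  · exact (hsum.update_of_ne (by omega)).update_of_ne (by omega)
  · exact (hter.update_self w _).update_of_ne (by omega)
  · have h3 : max (best w) (n - T.dist w u) = best w + (n - ℓ - best w) := by omega
    rw [h3]
    exact hbest₁.update_self w _

/-- The terminal vertices of `w` whose number is at least `i`. -/
noncomputable def terminalsFrom (T : SimpleGraph (Fin n)) (i : ℕ) (w : Fin n) : Finset (Fin n) :=
  (terminals T w).filter fun u => i ≤ u

theorem terminalsFrom_zero (T : SimpleGraph (Fin n)) (w : Fin n) :
    terminalsFrom T 0 w = terminals T w := by
  simp [terminalsFrom]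

theorem terminalsFrom_of_le (T : SimpleGraph (Fin n)) (w : Fin n) :
    terminalsFrom T n w = ∅ := by
  refine Finset.filter_false_of_mem fun u _ => ?_
  have := u.isLt
  omega

theorem notMem_terminalsFrom {u w : Fin n} : u ∉ terminalsFrom T (u + 1) w := by
  simp [terminalsFrom]

theorem terminalsFrom_of_isTerminal {u w : Fin n} (h : IsTerminal T w u) :
    terminalsFrom T u w = insert u (terminalsFrom T (u + 1) w) := by
  ext v
  simp only [terminalsFrom, Finset.mem_filter, Finset.mem_insert, mem_terminals]
  constructor
  · rintro ⟨h1, h2⟩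
    rcases h2.eq_or_lt with h3 | h3
    · exact Or.inl (Fin.ext h3.symm)
    · exact Or.inr ⟨h1, h3⟩
  · rintro (rfl | ⟨h1, h2⟩)
    · exact ⟨h, le_rfl⟩
    · exact ⟨h1, by omega⟩

theorem terminalsFrom_of_not_isTerminal {u w : Fin n} (h : ¬ IsTerminal T w u) :
    terminalsFrom T u w = terminalsFrom T (u + 1) w := by
  ext v
  simp only [terminalsFrom, Finset.mem_filter, mem_terminals]
  refine and_congr_right fun h1 => ?_
  have h2 : (u : ℕ) ≠ v := fun h2 => h (by rwa [Fin.ext h2])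
  omega

/-- Look at the vertex `i - 1`, where the register 7 holds `i`, and process it if it is a leaf. -/
def vertexStep : Program :=
  .block [.sub 7 7 2, .add 9 3 7, .load 9 9, .sub 9 9 2] (.ite 9 .skip leafStep)

theorem neighborSet_ncard_pos_of_isMajor (hT : T.IsTree) {m : Fin n} (hm : IsMajor T m)
    (u : Fin n) : 0 < (T.neighborSet u).ncard := by
  by_cases h : u = m
  · subst h
    unfold IsMajor at hm
    omega
  · obtain ⟨a, ha, -⟩ := exists_mem_branch hT h
    exact neighborSet_ncard_pos ha

theorem runs_vertices (hT : T.IsTree) {m : Fin n} (hm : IsMajor T m)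
    {W k x₉ x₁₀ x₁₁ x₁₂ x₁₃ x₁₄ : ℕ} {M : ℕ → ℕ} {Q : ℕ → State → Prop}
    (hW : 10 * (n * n) + 10 * n ≤ W)
    (hdeg : Table M (2 * n) (nbSum T fun _ => 1))
    (hsum : Table M (3 * n) (nbSum T fun v => (v : ℕ)))
    (hter : Table M (4 * n) fun _ : Fin n => 0) (hbest : Table M (5 * n) fun _ : Fin n => 0)
    (hQ : ∀ t M' x₉ x₁₀ x₁₁ x₁₂ x₁₃ x₁₄, t ≤ 28 * n + 1 →
      Table M' (4 * n) (fun w => (terminals T w).card) →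
      Table M' (5 * n) (fun w => (terminals T w).sup fun u => n - T.dist w u) →
      Q t ⟨regs [n, k, 1, 2 * n, 3 * n, 4 * n, 5 * n, 0, 0, x₉, x₁₀, x₁₁, x₁₂, x₁₃, x₁₄], M'⟩) :
    Runs W (.loop 7 vertexStep)
      ⟨regs [n, k, 1, 2 * n, 3 * n, 4 * n, 5 * n, n, 0, x₉, x₁₀, x₁₁, x₁₂, x₁₃, x₁₄], M⟩ Q := by
  -- A vertex costs at most 17 steps apart from the climb, and a leaf costs 11 more for each vertex
  -- of its leg.
  refine Runs.loop (j := n) (fun j t s => ∃ M x₉ x₁₀ x₁₁ x₁₂ x₁₃ x₁₄,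
    s = ⟨regs [n, k, 1, 2 * n, 3 * n, 4 * n, 5 * n, j, 0, x₉, x₁₀, x₁₁, x₁₂, x₁₃, x₁₄], M⟩ ∧
    j ≤ n ∧ t + 17 * j ≤ 17 * n + 11 * ∑ w, ∑ u ∈ terminalsFrom T j w, T.dist w u ∧
    Table M (2 * n) (nbSum T fun _ => 1) ∧ Table M (3 * n) (nbSum T fun v => (v : ℕ)) ∧
    Table M (4 * n) (fun w => (terminalsFrom T j w).card) ∧
    Table M (5 * n) (fun w => (terminalsFrom T j w).sup fun u => n - T.dist w u)) ?_ ?_ ?_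
  · rintro j t _ ⟨M, x₉, x₁₀, x₁₁, x₁₂, x₁₃, x₁₄, rfl, hj, ht, hdeg, hsum, hter, hbest⟩ hr
    replace hr : j ≠ 0 := hr
    obtain ⟨i, rfl⟩ := Nat.exists_eq_succ_of_ne_zero hr
    rw [Nat.succ_eq_add_one] at *
    obtain ⟨u, rfl⟩ : ∃ u : Fin n, (u : ℕ) = i := ⟨⟨i, hj⟩, rfl⟩
    have hdu := hdeg u
    have hdle : nbSum T (fun _ => 1) u ≤ n * 1 := nbSum_le T (fun _ => le_rfl) u
    simp only [vertexStep, runs_block_cons, runs_block_nil, Instr.value, Instr.apply]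
    simp only [update_regs, regs_apply, List.set_cons_succ, List.set_cons_zero, List.length_cons,
      List.length_nil, List.getD_cons_succ, List.getD_cons_zero, Nat.reduceAdd, Nat.reduceLT,
      Nat.add_sub_cancel, hdu]
    refine ⟨by omega, by omega, by omega, by omega, ?_⟩
    rw [nbSum_one]
    have hpos := neighborSet_ncard_pos_of_isMajor hT hm u
    by_cases hu : (T.neighborSet u).ncard - 1 = 0
    · have hleaf : IsLeaf T u := by
        unfold IsLeaf
        omega
      refine Runs.ite_of_eq hu ?_
      refine runs_leafStep hT hm hW hleaf hdeg hsum hter hbest ?_ ?_ ?_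
      · exact fun v => (Finset.card_le_univ _).trans (by simp)
      · exact fun v => Finset.sup_le fun _ _ => Nat.sub_le _ _
      intro t' w M' x₉ x₁₀ x₁₁ x₁₂ x₁₃ x₁₄ hw ht' hdeg' hsum' hter' hbest'
      have hother : ∀ v, v ≠ w → terminalsFrom T u v = terminalsFrom T (u + 1) v := fun v hv =>
        terminalsFrom_of_not_isTerminal fun h => hv (h.center_unique hw)
      have hins := terminalsFrom_of_isTerminal hw
      refine ⟨u, Nat.lt_succ_self _, M', x₉, x₁₀, x₁₁, x₁₂, x₁₃, x₁₄, rfl, by omega, ?_, hdeg',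
        hsum', ?_, ?_⟩
      · have hs : ∑ v, ∑ x ∈ terminalsFrom T u v, T.dist v x =
            T.dist w u + ∑ v, ∑ x ∈ terminalsFrom T (u + 1) v, T.dist v x := by
          rw [← Finset.add_sum_erase _ _ (Finset.mem_univ w),
            ← Finset.add_sum_erase _ (fun v => ∑ x ∈ terminalsFrom T (u + 1) v, T.dist v x)
              (Finset.mem_univ w), hins, Finset.sum_insert notMem_terminalsFrom, add_assoc]
          congr 2
          refine Finset.sum_congr rfl fun v hv => ?_
          rw [hother v (Finset.ne_of_mem_erase hv)]
        omega
      · intro v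
        rw [hter' v]
        beta_reduce
        by_cases hv : v = w
        · subst hv
          rw [Function.update_self, hins, Finset.card_insert_of_notMem notMem_terminalsFrom]
        · rw [Function.update_of_ne hv, hother v hv]
      · intro v
        rw [hbest' v]
        beta_reduce
        by_cases hv : v = w
        · subst hv
          rw [Function.update_self, hins, Finset.sup_insert]
          exact max_comm _ _
        · rw [Function.update_of_ne hv, hother v hv]
    · refine Runs.ite_of_ne hu ?_
      rw [runs_skip]
      have hsame : ∀ v, terminalsFrom T (u + 1) v = terminalsFrom T u v := fun v =>
        (terminalsFrom_of_not_isTerminal fun h => hu (by rw [show _ = _ from h.2.1])).symm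
      simp only [hsame] at ht hter hbest
      exact ⟨u, Nat.lt_succ_self _, M, _, _, _, _, _, _, rfl, by omega, by omega, hdeg, hsum, hter,
        hbest⟩
  · rintro j t _ ⟨M, x₉, x₁₀, x₁₁, x₁₂, x₁₃, x₁₄, rfl, hj, ht, hdeg, hsum, hter, hbest⟩ hr
    replace hr : j = 0 := hr
    subst hr
    simp only [terminalsFrom_zero] at ht hter hbest
    have := sum_dist_le_card hT
    rw [Fintype.card_fin] at this
    exact hQ _ _ _ _ _ _ _ _ (by omega) hter hbest
  · refine ⟨M, _, _, _, _, _, _, rfl, le_rfl, by omega, hdeg, hsum, ?_, ?_⟩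
    · simpa only [terminalsFrom_of_le, Finset.card_empty] using hter
    · simpa only [terminalsFrom_of_le, Finset.sup_empty, bot_eq_zero] using hbest

end Climb

/-! ### Evaluating the dimension formula -/

section Sum

variable {n : ℕ} {T : SimpleGraph (Fin n)}

/-- The program keeps a maximum of `n - T.dist w u`, which may start at `0`, in place of a minimum
of distances. -/
theorem sub_sup_eq_shortestLeg (hT : T.IsTree) {w : Fin n} (h : (terminals T w).Nonempty) :
    n - ((terminals T w).sup fun u => n - T.dist w u) = shortestLeg T w := by
  have hlt : ∀ u, IsTerminal T w u → T.dist w u < n := fun u hu => by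
    obtain ⟨b, hb⟩ := exists_leg_of_isTerminal hT hu
    have := hb.length_lt hT
    rwa [Nat.card_fin] at this
  obtain ⟨u, hu⟩ := h
  obtain ⟨v, hv, hvl⟩ := exists_shortestLeg (mem_terminals.1 hu)
  have h1 : ((terminals T w).sup fun u => n - T.dist w u) = n - shortestLeg T w := by
    refine le_antisymm (Finset.sup_le fun x hx => ?_) ?_
    · exact Nat.sub_le_sub_left (shortestLeg_le (mem_terminals.1 hx)) n
    · rw [← hvl]
      exact Finset.le_sup (f := fun u => n - T.dist w u) (mem_terminals.2 hv)
  have h2 := hlt v hv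
  omega

/-- Add the share of the vertex `i - 1` to the register 8, where the register 7 holds `i` and the
register 14 holds `2`. -/
def shareStep : Program :=
  .block [.sub 7 7 2, .add 9 5 7, .load 9 9, .sub 9 9 2]
    (.ite 9 (.block [.add 10 6 7, .load 10 10, .sub 10 0 10, .div 11 1 14, .sub 12 10 11,
      .sub 10 10 12, .add 8 8 10, .sub 11 1 10, .mul 11 9 11, .add 8 8 11] .skip) .skip)

/-- The sum of the shares of the vertices whose number is at least `i`. -/
noncomputable def shareFrom (T : SimpleGraph (Fin n)) (k i : ℕ) : ℕ :=
  ∑ w : Fin n, if i ≤ (w : ℕ) then share T k w else 0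

theorem shareFrom_eq_add (T : SimpleGraph (Fin n)) (k : ℕ) (u : Fin n) :
    shareFrom T k u = share T k u + shareFrom T k (u + 1) := by
  have h : ∀ w : Fin n, (if (u : ℕ) ≤ w then share T k w else 0) =
      (if w = u then share T k w else 0) + if (u : ℕ) + 1 ≤ w then share T k w else 0 := by
    intro w
    by_cases hw : w = u
    · subst hw
      simp
    · have : (u : ℕ) ≠ w := fun h => hw (Fin.ext h.symm)
      rw [if_neg hw, zero_add]
      exact if_congr (by omega) rfl rfl
  simp only [shareFrom, h, Finset.sum_add_distrib, Finset.sum_ite_eq', Finset.mem_univ, if_true]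

theorem shareFrom_zero (T : SimpleGraph (Fin n)) (k : ℕ) :
    shareFrom T k 0 = ∑ w, share T k w := by
  simp [shareFrom]

theorem shareFrom_of_le (T : SimpleGraph (Fin n)) (k : ℕ) : shareFrom T k n = 0 := by
  refine Finset.sum_eq_zero fun w _ => if_neg ?_
  have := w.isLt
  omega

theorem shareFrom_le (T : SimpleGraph (Fin n)) (k i : ℕ) :
    shareFrom T k i ≤ ∑ w, share T k w := by
  refine Finset.sum_le_sum fun w _ => ?_
  split_ifs
  · exact le_rfl
  · exact Nat.zero_le _

/-- Partial sums of the dimension formula fit into a word, since the dimension is at most the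
order. -/
theorem sum_share_le (hT : T.IsTree) {k : ℕ} (hk : 1 ≤ k) (hks : k ≤ sigma T) :
    ∑ w, share T k w ≤ n := by
  obtain ⟨S, -, hS⟩ := exists_isGenerator hT hk hks
  rw [← hS]
  exact (Finset.card_le_univ S).trans (by simp)

theorem le_two_mul (hT : T.IsTree) {k : ℕ} (hk : 1 ≤ k) (hks : k ≤ sigma T) : k ≤ 2 * n := by
  obtain ⟨w, u, v, hu, hv, huv⟩ := exists_two_terminals hk hks
  have h1 := hks.trans (sigma_le_add hu hv huv)
  obtain ⟨b, hb⟩ := exists_leg_of_isTerminal hT hu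
  obtain ⟨c, hc⟩ := exists_leg_of_isTerminal hT hv
  have h2 := hb.length_lt hT
  have h3 := hc.length_lt hT
  rw [Nat.card_fin] at h2 h3
  omega

theorem runs_shares (hT : T.IsTree) {W k x₉ x₁₀ x₁₁ x₁₂ x₁₃ : ℕ} {M : ℕ → ℕ}
    {Q : ℕ → State → Prop} (hk : 1 ≤ k) (hks : k ≤ sigma T)
    (hW : 10 * (n * n) + 10 * n ≤ W)
    (hter : Table M (4 * n) fun w => (terminals T w).card)
    (hbest : Table M (5 * n) fun w => (terminals T w).sup fun u => n - T.dist w u)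
    (hQ : ∀ t x₉ x₁₀ x₁₁ x₁₂, t ≤ 17 * n + 1 →
      Q t ⟨regs [n, k, 1, 2 * n, 3 * n, 4 * n, 5 * n, 0, ∑ w, share T k w,
        x₉, x₁₀, x₁₁, x₁₂, x₁₃, 2], M⟩) :
    Runs W (.loop 7 shareStep)
      ⟨regs [n, k, 1, 2 * n, 3 * n, 4 * n, 5 * n, n, 0, x₉, x₁₀, x₁₁, x₁₂, x₁₃, 2], M⟩ Q := by
  refine Runs.loop (j := n) (fun j t s => ∃ x₉ x₁₀ x₁₁ x₁₂,
    s = ⟨regs [n, k, 1, 2 * n, 3 * n, 4 * n, 5 * n, j, shareFrom T k j,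
      x₉, x₁₀, x₁₁, x₁₂, x₁₃, 2], M⟩ ∧ j ≤ n ∧ t + 17 * j ≤ 17 * n) ?_ ?_ ?_
  · rintro j t _ ⟨x₉, x₁₀, x₁₁, x₁₂, rfl, hj, ht⟩ hr
    replace hr : j ≠ 0 := hr
    obtain ⟨i, rfl⟩ := Nat.exists_eq_succ_of_ne_zero hr
    rw [Nat.succ_eq_add_one] at *
    obtain ⟨w, rfl⟩ : ∃ w : Fin n, (w : ℕ) = i := ⟨⟨i, hj⟩, rfl⟩
    have htw := hter w
    have hbw := hbest w
    have hcard : (terminals T w).card ≤ n := (Finset.card_le_univ _).trans (by simp)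
    have hsup : ((terminals T w).sup fun u => n - T.dist w u) ≤ n :=
      Finset.sup_le fun _ _ => Nat.sub_le _ _
    have hk2 := le_two_mul hT hk hks
    have hle := (shareFrom_le T k w).trans (sum_share_le hT hk hks)
    have hadd := shareFrom_eq_add T k w
    have hdeg := terminalDegree_eq T w
    simp only [shareStep, runs_block_cons, runs_block_nil, Instr.value, Instr.apply]
    simp only [update_regs, regs_apply, List.set_cons_succ, List.set_cons_zero, List.length_cons,
      List.length_nil, List.getD_cons_succ, List.getD_cons_zero, Nat.reduceAdd, Nat.reduceLT,
      Nat.add_sub_cancel, htw]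
    refine ⟨by omega, by omega, by omega, by omega, ?_⟩
    by_cases h : 1 < (terminals T w).card
    · have hne : (terminals T w).card - 1 ≠ 0 := by omega
      refine Runs.ite_of_ne hne ?_
      have hshort := sub_sup_eq_shortestLeg hT (Finset.card_pos.1 (lt_trans one_pos h))
      have hmin : shortestLeg T w - (shortestLeg T w - k / 2) = shortShare T k w := by
        unfold shortShare
        omega
      have hsle : shortestLeg T w ≤ n := by omega
      have hsk : shortShare T k w ≤ k / 2 := min_le_right _ _
      rw [share, if_pos (by rwa [hdeg]), hdeg] at hadd
      simp only [runs_block_cons, runs_block_nil, runs_skip, Instr.value, Instr.apply]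
      simp only [update_regs, regs_apply, List.set_cons_succ, List.set_cons_zero, List.length_cons,
        List.length_nil, List.getD_cons_succ, List.getD_cons_zero, Nat.reduceAdd, Nat.reduceLT,
        hbw, hshort, hmin]
      rw [show shareFrom T k (w + 1) + shortShare T k w +
        ((terminals T w).card - 1) * (k - shortShare T k w) = shareFrom T k w by omega]
      exact ⟨by omega, by omega, by omega, by omega, by omega, by omega, by omega, by omega,
        by omega, by omega, w, Nat.lt_succ_self _, _, _, _, _, rfl, by omega, by omega⟩
    · have heq : (terminals T w).card - 1 = 0 := by omega
      refine Runs.ite_of_eq heq ?_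
      rw [runs_skip]
      rw [share, if_neg (by rwa [hdeg]), zero_add] at hadd
      rw [← hadd]
      exact ⟨w, Nat.lt_succ_self _, _, _, _, _, rfl, by omega, by omega⟩
  · rintro j t _ ⟨x₉, x₁₀, x₁₁, x₁₂, rfl, hj, ht⟩ hr
    replace hr : j = 0 := hr
    subst hr
    rw [shareFrom_zero]
    exact hQ _ _ _ _ _ (by omega)
  · exact ⟨_, _, _, _, by rw [shareFrom_of_le], le_rfl, by omega⟩

/-- The program that computes the `k`-metric dimension of a tree. The register 2 holds `1`, and the
registers 3 to 6 hold the addresses `2 * n`, …, `5 * n` of four tables with one entry for each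
vertex: the degrees, the sums of the neighbours, the terminal degrees, and `n` minus the length of a
shortest leg. The register 7 counts the rounds of each loop down to zero, and the register 8
accumulates the result. -/
def dimensionProgram : Program :=
  .block [.const 2 1, .add 3 0 0, .add 4 3 0, .add 5 4 0, .add 6 5 0, .sub 7 0 2]
    (.seq (.loop 7 edgeStep) (.block [.move 7 0]
      (.seq (.loop 7 vertexStep) (.block [.const 14 2, .move 7 0]
        (.seq (.loop 7 shareStep) (.block [.move 0 8] .skip))))))

theorem inputState_eq (n k : ℕ) (L : List (Fin n × Fin n)) :
    inputState n k L = ⟨regs [n, k, 0, 0, 0, 0, 0, 0, 0, 0, 0, 0, 0, 0, 0],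
      fun a => (L.flatMap fun e => [(e.1 : ℕ), (e.2 : ℕ)]).getD a 0⟩ := by
  rw [inputState]
  congr 1
  funext r
  rw [regs_apply]
  by_cases h : r < 15
  · interval_cases r <;> rfl
  · rw [if_neg (by omega), if_neg (by omega), List.getD_eq_default]
    simpa using h

theorem runs_dimensionProgram (hT : T.IsTree) {k W : ℕ} {L : List (Fin n × Fin n)}
    (hL : IsEdgeList T L) (hk : 1 ≤ k) (hks : k ≤ sigma T)
    (hW : 10 * (n * n) + 10 * n ≤ W) :
    Runs W dimensionProgram (inputState n k L) fun t s =>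
      t ≤ 90 * n ∧ s.reg 0 = ∑ w, share T k w := by
  obtain ⟨m, _, _, hm, -, -⟩ := exists_two_terminals hk hks
  have hlen := hL.length_add_one hT
  have hn : 1 ≤ n := by omega
  have hdim := sum_share_le hT hk hks
  have e1 : n - 1 = L.length := by omega
  have e2 : n + n = 2 * n := by omega
  have e3 : 2 * n + n = 3 * n := by omega
  have e4 : 3 * n + n = 4 * n := by omega
  have e5 : 4 * n + n = 5 * n := by omega
  rw [inputState_eq]
  simp only [dimensionProgram, runs_block_cons, runs_block_nil, runs_seq, runs_skip, Instr.value,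
    Instr.apply]
  simp only [update_regs, regs_apply, List.set_cons_succ, List.set_cons_zero, List.length_cons,
    List.length_nil, List.getD_cons_succ, List.getD_cons_zero, Nat.reduceAdd, Nat.reduceLT]
  rw [e1, e2, e3, e4, e5]
  refine ⟨by omega, by omega, by omega, by omega, by omega, by omega, ?_⟩
  refine runs_edges hW hlen (fun _ => rfl) fun t₁ M₁ x₉ x₁₀ x₁₁ x₁₂ ht₁ hdeg hsum hter hbest => ?_
  rw [hL.edgeSum_eq] at hdeg hsum
  simp only [regs_apply, update_regs, List.set_cons_succ, List.set_cons_zero, List.length_cons,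
    List.length_nil, List.getD_cons_zero, Nat.reduceAdd, Nat.reduceLT]
  refine ⟨by omega, ?_⟩
  refine runs_vertices hT hm.1 hW hdeg hsum hter hbest
    fun t₂ M₂ x₉ x₁₀ x₁₁ x₁₂ x₁₃ x₁₄ ht₂ hter hbest => ?_
  simp only [regs_apply, update_regs, List.set_cons_succ, List.set_cons_zero, List.length_cons,
    List.length_nil, List.getD_cons_zero, Nat.reduceAdd, Nat.reduceLT]
  refine ⟨by omega, by omega, ?_⟩
  refine runs_shares hT hk hks hW hter hbest fun t₃ x₉ x₁₀ x₁₁ x₁₂ ht₃ => ?_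
  simp only [regs_apply, update_regs, List.set_cons_zero, List.length_cons, List.length_nil,
    List.getD_cons_succ, List.getD_cons_zero, Nat.reduceAdd, Nat.reduceLT]
  exact ⟨by omega, by omega, trivial⟩

end Sum

end KMetric

/-- One program computes `dim_k(T)`, for all trees `T` different from a path and all positive
`k ≤ ς(T)`, in at most `c * n` steps on words of `d * log₂ n` bits, where `n` is the order of `T`.
The output is in the register 0. -/
theorem mainTheorem8 :
    ∃ (P : KMetric.Program) (c d : ℕ),
      ∀ (n k : ℕ) (T : SimpleGraph (Fin n)) (L : List (Fin n × Fin n)),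
        T.IsTree → ¬ KMetric.IsPathGraph T → KMetric.IsEdgeList T L →
        1 ≤ k → k ≤ KMetric.sigma T →
        ∃ (t : ℕ) (s : KMetric.State),
          KMetric.Exec (n ^ d) P (KMetric.inputState n k L) t s ∧
          t ≤ c * n ∧ KMetric.IsDimension T k (s.reg 0) := by
  refine ⟨KMetric.dimensionProgram, 90, 4, fun n k T L hT _ hL hk hks => ?_⟩
  -- A major vertex has three neighbours, so that `n ^ 4` exceeds all numbers that occur: addresses
  -- are less than `6 * n`, and sums of neighbours are at most `n * n`.
  have hn : 4 ≤ n := by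
    obtain ⟨w, _, _, hw, -, -⟩ := KMetric.exists_two_terminals hk hks
    have h1 : (T.neighborSet w).ncard < Nat.card (Fin n) := by
      rw [← Set.ncard_univ]
      exact Set.ncard_lt_ncard ⟨Set.subset_univ _, fun h => T.irrefl (h (Set.mem_univ w))⟩
    have h2 : 3 ≤ (T.neighborSet w).ncard := hw.1
    rw [Nat.card_fin] at h1
    omega
  have hW : 10 * (n * n) + 10 * n ≤ n ^ 4 := by
    have h1 : n * 4 ≤ n * n := Nat.mul_le_mul_left n hn
    have h2 : (4 * 4) * (n * n) ≤ (n * n) * (n * n) :=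
      Nat.mul_le_mul_right _ (Nat.mul_le_mul hn hn)
    have h3 : n ^ 4 = (n * n) * (n * n) := by ring
    omega
  obtain ⟨t, s, he, ht, hs⟩ := KMetric.runs_dimensionProgram hT hL hk hks hW
  refine ⟨t, s, he, ht, ?_⟩
  rw [hs]
  exact KMetric.isDimension_sum_share hT hk hks
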